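/- \textbf{Conventions.} All functions are real-valued. For $F$ integrable near $x$, $F$ is Laplace differentiable at $x$ with $LD_1F(x)=d$ if for some $\delta>0$ $$\lim_{s\to\infty}s^2\int_0^\delta e^{-st}[F(x+t)-F(x)]\,dt=d=\lim_{s\to\infty}(-s^2)\int_0^\delta e^{-st}[F(x-t)-F(x)]\,dt ;$$ at an end point of a compact interval only the limit from inside the interval is used. Replacing the limits by lower (upper) limits gives the lower (upper) Laplace derivates. A continuous $U$ on $[a,b]$ is a major function of $g$ if its one-sided lower Laplace derivates are everywhere $\ge g$ (hence $>-\infty$); a continuous $V$ is a minor function of $g$ if its one-sided upper Laplace derivates are everywhere $\le g$. $g$ is Laplace integrable on $[a,b]$, $g\in\mathcal{LP}[a,b]$, if $\inf_U (U(b)-U(a))=\sup_V (V(b)-V(a))$ is finite, and this common value is $\int_a^b g$. Laplace integrability on $[a,\infty)$ means Laplace integrability on $[a,c]$ for all $c\ge a$ and existence of $\int_a^\infty g=\lim_{c\to\infty}\int_a^c g$, similarly on $(-\infty,a]$; $g\in\mathcal{LP}(\mathbb R)$ if for some $a$ it is Laplace integrable on $(-\infty,a]$ and on $[a,\infty)$,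 and $\int_{-\infty}^\infty g=\int_{-\infty}^a g+\int_a^\infty g$. $\mathcal{HK}[a,b]$ and $\mathcal{HK}(\mathbb R)$ are the classes of Henstock--Kurzweil integrable functions (on $\mathbb R$: with gauges on $[-\infty,\infty]$, the unbounded subintervals contributing $0$). \textbf{Statement.} \begin{enumerate} \item There are functions $f,\phi$ on $[0,1]$ such that $f$ is continuous and Laplace differentiable on $[0,1]$ with $LD_1f=\phi$, $f(0)=f(1)=\phi(0)=\phi(1)=0$, and $\phi\in\mathcal{LP}[0,1]\setminus\mathcal{HK}[0,1]$. \item For all such $f,\phi$, let $F$ and $\Phi$ be the functions on $\mathbb R$ that equal $f$ and $\phi$, respectively, on $[0,1]$ and $0$ on $\mathbb R\setminus[0,1]$. Then $F$ is continuous and Laplace differentiable on $\mathbb R$, $LD_1F=\Phi$ on $\mathbb R$, and $\Phi\in\mathcal{LP}(\mathbb R)\setminus\mathcal{HK}(\mathbb R)$. \item Hence $\mathcal{LP}(\mathbb R)\setminus\mathcal{HK}(\mathbb R)\neq\emptyset$, and the Laplace integral on $\mathbb R$ strictly generalises the Henstock--Kurzweil integral: every $g\in\mathcal{HK}(\mathbb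 R)$ is Laplace integrable on $\mathbb R$ with the same integral, and $\mathcal{HK}(\mathbb R)\subsetneq\mathcal{LP}(\mathbb R)$. \end{enumerate} -/

import Mathlib

open Filter Topology MeasureTheory

namespace LaplaceInt

/-! ## Laplace derivates and the Laplace derivative of order one -/

/-- `s² ∫₀^δ e^{-st} [f(x+t) - f(x)] dt`. -/
noncomputable def rightQuot (f : ℝ → ℝ) (x δ s : ℝ) : ℝ :=
  s ^ 2 * ∫ t in (0 : ℝ)..δ, Real.exp (-(s * t)) * (f (x + t) - f x)

/-- `(-s²) ∫₀^δ e^{-st} [f(x-t) - f(x)] dt`. -/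
noncomputable def leftQuot (f : ℝ → ℝ) (x δ s : ℝ) : ℝ :=
  -(s ^ 2) * ∫ t in (0 : ℝ)..δ, Real.exp (-(s * t)) * (f (x - t) - f x)

/-- `LD₁ f(x) = d` at a point of the real line, for `f` integrable near `x`. It is only applied
to continuous functions, for which the integral defining it is the ordinary one. -/
def HasLaplaceDerivAt (f : ℝ → ℝ) (d x : ℝ) : Prop :=
  ∃ δ : ℝ, 0 < δ ∧ IntervalIntegrable f volume (x - δ) (x + δ) ∧
    Tendsto (rightQuot f x δ) atTop (𝓝 d) ∧ Tendsto (leftQuot f x δ) atTop (𝓝 d)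

/-- `LD₁ f = φ` on the compact interval `[a, b]`: both one-sided limits exist and equal `φ(x)`
at interior points, and at the end points the one-sided limit from within `[a, b]` does.
(The value of such a limit does not depend on `δ`.) -/
def HasLaplaceDerivOn (f φ : ℝ → ℝ) (a b : ℝ) : Prop :=
  (∀ x ∈ Set.Ico a b, ∃ δ : ℝ, 0 < δ ∧ x + δ ≤ b ∧ IntervalIntegrable f volume x (x + δ) ∧
    Tendsto (rightQuot f x δ) atTop (𝓝 (φ x))) ∧
  (∀ x ∈ Set.Ioc a b, ∃ δ : ℝ, 0 < δ ∧ a ≤ x - δ ∧ IntervalIntegrable f volume (x - δ) x ∧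
    Tendsto (leftQuot f x δ) atTop (𝓝 (φ x)))

/-! ## The Laplace integral -/

/-- `U` is a (continuous) major function of `f` on `[a, b]`: its lower Laplace derivates, one-sided
at the end points, are at least `f`; as `f` is real-valued they are then greater than `-∞`. -/
structure IsMajor (U f : ℝ → ℝ) (a b : ℝ) : Prop where
  cont : ContinuousOn U (Set.Icc a b)
  right : ∀ x ∈ Set.Ico a b, ∃ δ : ℝ, 0 < δ ∧ x + δ ≤ b ∧
    ((f x : ℝ) : EReal) ≤ liminf (fun s : ℝ => ((rightQuot U x δ s : ℝ) : EReal)) atTop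
  left : ∀ x ∈ Set.Ioc a b, ∃ δ : ℝ, 0 < δ ∧ a ≤ x - δ ∧
    ((f x : ℝ) : EReal) ≤ liminf (fun s : ℝ => ((leftQuot U x δ s : ℝ) : EReal)) atTop

/-- `V` is a (continuous) minor function of `f` on `[a, b]`. -/
structure IsMinor (V f : ℝ → ℝ) (a b : ℝ) : Prop where
  cont : ContinuousOn V (Set.Icc a b)
  right : ∀ x ∈ Set.Ico a b, ∃ δ : ℝ, 0 < δ ∧ x + δ ≤ b ∧
    limsup (fun s : ℝ => ((rightQuot V x δ s : ℝ) : EReal)) atTop ≤ ((f x : ℝ) : EReal)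
  left : ∀ x ∈ Set.Ioc a b, ∃ δ : ℝ, 0 < δ ∧ a ≤ x - δ ∧
    limsup (fun s : ℝ => ((leftQuot V x δ s : ℝ) : EReal)) atTop ≤ ((f x : ℝ) : EReal)

/-- `f` is Laplace integrable on `[a, b]` with integral `A`: the infimum of `U(b) - U(a)` over
major functions and the supremum of `V(b) - V(a)` over minor functions both equal `A`. -/
def HasLaplaceIntegral (f : ℝ → ℝ) (a b A : ℝ) : Prop :=
  IsGLB {y : ℝ | ∃ U : ℝ → ℝ, IsMajor U f a b ∧ y = U b - U a} A ∧
  IsLUB {y : ℝ | ∃ V : ℝ → ℝ, IsMinor V f a b ∧ y = V b - V a} A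

/-- Laplace integral over `[a, ∞)`; `G c` is the integral over `[a, c]`. -/
def HasLaplaceIntegralIci (f : ℝ → ℝ) (a A : ℝ) : Prop :=
  ∃ G : ℝ → ℝ, (∀ c, a ≤ c → HasLaplaceIntegral f a c (G c)) ∧ Tendsto G atTop (𝓝 A)

/-- Laplace integral over `(-∞, b]`; `G c` is the integral over `[c, b]`. -/
def HasLaplaceIntegralIic (f : ℝ → ℝ) (b A : ℝ) : Prop :=
  ∃ G : ℝ → ℝ, (∀ c, c ≤ b → HasLaplaceIntegral f c b (G c)) ∧ Tendsto G atBot (𝓝 A)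

/-- Laplace integral over the real line. -/
def HasLaplaceIntegralReal (f : ℝ → ℝ) (A : ℝ) : Prop :=
  ∃ a A₁ A₂ : ℝ, HasLaplaceIntegralIic f a A₁ ∧ HasLaplaceIntegralIci f a A₂ ∧ A = A₁ + A₂

/-- The set `LP[a, b]`. -/
def LPIcc (a b : ℝ) : Set (ℝ → ℝ) := {f | ∃ A, HasLaplaceIntegral f a b A}

/-- The set `LP(ℝ)`. -/
def LPReal : Set (ℝ → ℝ) := {f | ∃ A, HasLaplaceIntegralReal f A}

/-! ## The Henstock–Kurzweil integral -/

/-- The points `x 0 ≤ ⋯ ≤ x n` with tags `ξ i ∈ [x i, x (i+1)]` form a `δ`-fine tagged partition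
of `[a, b]`. (Degenerate subintervals are harmless: they contribute `0` to Riemann sums.) -/
def IsFinePartition (δ : ℝ → ℝ) (a b : ℝ) (n : ℕ) (x ξ : ℕ → ℝ) : Prop :=
  x 0 = a ∧ x n = b ∧ ∀ i < n, x i ≤ ξ i ∧ ξ i ≤ x (i + 1) ∧
    ξ i - δ (ξ i) < x i ∧ x (i + 1) < ξ i + δ (ξ i)

/-- The Riemann sum of `f` over a tagged partition. -/
def riemannSum (f : ℝ → ℝ) (n : ℕ) (x ξ : ℕ → ℝ) : ℝ :=
  ∑ i ∈ Finset.range n, f (ξ i) * (x (i + 1) - x i)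

/-- Henstock–Kurzweil integral over `[a, b]`. -/
def HasHKIntegral (f : ℝ → ℝ) (a b A : ℝ) : Prop :=
  ∀ ε : ℝ, 0 < ε → ∃ δ : ℝ → ℝ, (∀ t, 0 < δ t) ∧
    ∀ (n : ℕ) (x ξ : ℕ → ℝ), IsFinePartition δ a b n x ξ → |riemannSum f n x ξ - A| < ε

/-- Henstock–Kurzweil integral over the real line. A gauge on `[-∞, ∞]` is a gauge `δ` on `ℝ` with
neighbourhoods `[-∞, -r)` and `(r, ∞]` of the infinite points. In a fine partition of `[-∞, ∞]`
the unbounded subintervals `[-∞, u]`, `[v, ∞]` have the tags `-∞`, `∞` and contribute `0`, which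
leaves a fine partition of `[u, v]` with `u < -r` and `r < v`. -/
def HasHKIntegralReal (f : ℝ → ℝ) (A : ℝ) : Prop :=
  ∀ ε : ℝ, 0 < ε → ∃ (δ : ℝ → ℝ) (r : ℝ), (∀ t, 0 < δ t) ∧ 0 < r ∧
    ∀ u v : ℝ, u < -r → r < v → ∀ (n : ℕ) (x ξ : ℕ → ℝ), IsFinePartition δ u v n x ξ →
      |riemannSum f n x ξ - A| < ε

/-- The set `HK[a, b]`. -/
def HKIcc (a b : ℝ) : Set (ℝ → ℝ) := {f | ∃ A, HasHKIntegral f a b A}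

/-- The set `HK(ℝ)`. -/
def HKReal : Set (ℝ → ℝ) := {f | ∃ A, HasHKIntegralReal f A}

/-! ## The functions on the unit interval that are extended by zero -/

/-- `f` is continuous on `[0, 1]` with Laplace derivative `φ` there, `f` and `φ` vanish at `0` and
`1`, and `φ` is Laplace integrable but not Henstock–Kurzweil integrable on `[0, 1]`. -/
structure IsUnitExample (f φ : ℝ → ℝ) : Prop where
  cont : ContinuousOn f (Set.Icc 0 1)
  deriv : HasLaplaceDerivOn f φ 0 1
  f_zero : f 0 = 0
  f_one : f 1 = 0
  phi_zero : φ 0 = 0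
  phi_one : φ 1 = 0
  mem_LP : φ ∈ LPIcc 0 1
  not_mem_HK : φ ∉ HKIcc 0 1

/-- Extension by zero of the restriction of `f` to `[0, 1]`. -/
noncomputable def extendZero (f : ℝ → ℝ) : ℝ → ℝ := (Set.Icc (0 : ℝ) 1).indicator f

end LaplaceInt

namespace LaplaceInt

/-! ## Elementary properties of the Laplace quotients -/

theorem coe_le_liminf_coe_iff {u : ℝ → ℝ} {a : ℝ} :
    ((a : ℝ) : EReal) ≤ liminf (fun s : ℝ => ((u s : ℝ) : EReal)) atTop ↔
      ∀ c < a, ∀ᶠ s in atTop, c < u s := by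
  rw [le_liminf_iff]
  constructor
  · intro h c hc
    filter_upwards [h c (EReal.coe_lt_coe_iff.2 hc)] with s hs
    exact EReal.coe_lt_coe_iff.1 hs
  · intro h y hy
    obtain ⟨q, hq, hq'⟩ := EReal.lt_iff_exists_real_btwn.1 hy
    filter_upwards [h q (EReal.coe_lt_coe_iff.1 hq')] with s hs
    exact hq.trans (EReal.coe_lt_coe_iff.2 hs)

theorem limsup_coe_le_coe_iff {u : ℝ → ℝ} {a : ℝ} :
    limsup (fun s : ℝ => ((u s : ℝ) : EReal)) atTop ≤ ((a : ℝ) : EReal) ↔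
      ∀ c, a < c → ∀ᶠ s in atTop, u s < c := by
  rw [limsup_le_iff]
  constructor
  · intro h c hc
    filter_upwards [h c (EReal.coe_lt_coe_iff.2 hc)] with s hs
    exact EReal.coe_lt_coe_iff.1 hs
  · intro h y hy
    obtain ⟨q, hq, hq'⟩ := EReal.lt_iff_exists_real_btwn.1 hy
    filter_upwards [h q (EReal.coe_lt_coe_iff.1 hq)] with s hs
    exact (EReal.coe_lt_coe_iff.2 hs).trans hq'

/-- The reflection y ↦ -f(-y) lets every left-sided statement follow from its right-sided version.
-/
theorem leftQuot_eq_rightQuot (f : ℝ → ℝ) (x δ s : ℝ) :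
    leftQuot f x δ s = rightQuot (fun y => -f (-y)) (-x) δ s := by
  unfold leftQuot rightQuot
  rw [neg_mul, ← mul_neg, ← intervalIntegral.integral_neg]
  congr 2
  ext t
  simp only [neg_neg, show -(-x + t) = x - t by ring]
  ring

theorem rightQuot_neg (f : ℝ → ℝ) (x δ s : ℝ) :
    rightQuot (fun y => -f y) x δ s = -rightQuot f x δ s := by
  unfold rightQuot
  rw [← mul_neg, ← intervalIntegral.integral_neg]
  congr 2
  ext t
  ring

theorem leftQuot_neg (f : ℝ → ℝ) (x δ s : ℝ) :
    leftQuot (fun y => -f y) x δ s = -leftQuot f x δ s := by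
  rw [leftQuot_eq_rightQuot, leftQuot_eq_rightQuot, ← rightQuot_neg]

theorem intervalIntegrable_exp_mul_sub {f : ℝ → ℝ} {x δ : ℝ}
    (hf : IntervalIntegrable f volume x (x + δ)) (s : ℝ) :
    IntervalIntegrable (fun t => Real.exp (-(s * t)) * (f (x + t) - f x)) volume 0 δ := by
  have h := hf.comp_add_left x
  simp only [sub_self, add_sub_cancel_left] at h
  exact (h.sub intervalIntegrable_const).continuousOn_mul (by fun_prop)

theorem intervalIntegrable_neg_comp_neg {f : ℝ → ℝ} {x δ : ℝ}
    (hf : IntervalIntegrable f volume (x - δ) x) :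
    IntervalIntegrable (fun y => -f (-y)) volume (-x) (-x + δ) := by
  have h := ((hf.comp_sub_left 0).symm).neg
  simp only [zero_sub] at h
  rwa [show -(x - δ) = -x + δ by ring] at h

/-- The part of the integral over [δ', δ] is at most s²e^{-sδ'} times a constant. Hence the choice
of δ affects neither limits nor upper and lower limits. -/
theorem tendsto_rightQuot_sub {f : ℝ → ℝ} {x δ δ' : ℝ} (h0 : 0 < δ') (h1 : δ' ≤ δ)
    (hf : IntervalIntegrable f volume x (x + δ)) :
    Tendsto (fun s => rightQuot f x δ s - rightQuot f x δ' s) atTop (𝓝 0) := by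
  have hg : IntervalIntegrable (fun t => f (x + t) - f x) volume 0 δ := by
    simpa using intervalIntegrable_exp_mul_sub hf 0
  have hsub : Set.uIcc δ' δ ⊆ Set.uIcc 0 δ := by
    rw [Set.uIcc_of_le h1, Set.uIcc_of_le (h0.le.trans h1)]
    exact Set.Icc_subset_Icc_left h0.le
  have hsub' : Set.uIcc 0 δ' ⊆ Set.uIcc 0 δ := by
    rw [Set.uIcc_of_le h0.le, Set.uIcc_of_le (h0.le.trans h1)]
    exact Set.Icc_subset_Icc_right h1
  have hlim : Tendsto (fun s : ℝ => (s ^ 2 * Real.exp (-(s * δ'))) *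
      ∫ t in δ'..δ, |f (x + t) - f x|) atTop (𝓝 0) := by
    have h2 : Tendsto (fun s : ℝ => s ^ 2 * Real.exp (-(s * δ'))) atTop (𝓝 0) := by
      have h3 := (Real.tendsto_pow_mul_exp_neg_atTop_nhds_zero 2).comp
        (tendsto_id.atTop_mul_const h0)
      have h4 := h3.const_mul ((δ' ^ 2)⁻¹)
      rw [mul_zero] at h4
      refine h4.congr fun s => ?_
      simp only [Function.comp, id]
      field_simp
    simpa using h2.mul_const (∫ t in δ'..δ, |f (x + t) - f x|)
  refine squeeze_zero_norm' ?_ hlim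
  filter_upwards [eventually_ge_atTop 0] with s hs
  have he := intervalIntegrable_exp_mul_sub hf s
  unfold rightQuot
  rw [← mul_sub, intervalIntegral.integral_interval_sub_left he (he.mono_set hsub'), norm_mul,
    Real.norm_eq_abs, abs_of_nonneg (sq_nonneg s), mul_assoc]
  refine mul_le_mul_of_nonneg_left ?_ (sq_nonneg s)
  refine (intervalIntegral.norm_integral_le_integral_norm h1).trans ?_
  rw [← intervalIntegral.integral_const_mul]
  refine intervalIntegral.integral_mono_on h1 (he.mono_set hsub).norm
    ((hg.mono_set hsub).norm.const_mul _) fun t ht => ?_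
  rw [norm_mul, Real.norm_eq_abs, Real.norm_eq_abs, Real.abs_exp]
  refine mul_le_mul_of_nonneg_right (Real.exp_le_exp.2 ?_) (abs_nonneg _)
  have := mul_le_mul_of_nonneg_left ht.1 hs
  linarith

theorem tendsto_rightQuot_congr {f : ℝ → ℝ} {x δ δ' d : ℝ} (h0 : 0 < δ') (h1 : δ' ≤ δ)
    (hf : IntervalIntegrable f volume x (x + δ)) :
    Tendsto (rightQuot f x δ) atTop (𝓝 d) ↔ Tendsto (rightQuot f x δ') atTop (𝓝 d) := by
  have h := tendsto_rightQuot_sub h0 h1 hf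
  constructor <;> intro h2
  · simpa using h2.sub h
  · simpa using h2.add h

theorem tendsto_leftQuot_congr {f : ℝ → ℝ} {x δ δ' d : ℝ} (h0 : 0 < δ') (h1 : δ' ≤ δ)
    (hf : IntervalIntegrable f volume (x - δ) x) :
    Tendsto (leftQuot f x δ) atTop (𝓝 d) ↔ Tendsto (leftQuot f x δ') atTop (𝓝 d) := by
  simp only [funext (leftQuot_eq_rightQuot f x _)]
  exact tendsto_rightQuot_congr h0 h1 (intervalIntegrable_neg_comp_neg hf)

theorem tendsto_sq_mul_integral_exp_mul_id {δ : ℝ} (hδ : 0 < δ) :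
    Tendsto (fun s : ℝ => s ^ 2 * ∫ t in (0 : ℝ)..δ, Real.exp (-(s * t)) * t) atTop (𝓝 1) := by
  have h1 : Tendsto (fun s : ℝ => 1 - (Real.exp (-(s * δ)) + (s * δ) ^ 1 * Real.exp (-(s * δ))))
      atTop (𝓝 1) := by
    have h3 := (Real.tendsto_pow_mul_exp_neg_atTop_nhds_zero 1).comp
        (tendsto_id.atTop_mul_const hδ)
    have h4 := Real.tendsto_exp_neg_atTop_nhds_zero.comp (tendsto_id.atTop_mul_const hδ)
    simpa using tendsto_const_nhds.sub (h4.add h3)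
  refine h1.congr' ?_
  filter_upwards [eventually_gt_atTop 0] with s hs
  have h5 : ∀ t ∈ Set.uIcc 0 δ, HasDerivAt
      (fun t => -(Real.exp (-(s * t)) * (1 + s * t)) / s ^ 2) (Real.exp (-(s * t)) * t) t := by
    intro t _
    have h6 : HasDerivAt (fun t : ℝ => s * t) s t := by simpa using (hasDerivAt_id t).const_mul s
    have h7 := ((h6.neg.exp.mul (h6.const_add 1)).neg).div_const (s ^ 2)
    refine h7.congr_deriv ?_
    simp only [Pi.neg_apply]
    field_simp
    ring
  rw [intervalIntegral.integral_eq_sub_of_hasDerivAt h5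
    (Continuous.intervalIntegrable (by fun_prop) _ _)]
  simp only [mul_zero, neg_zero, Real.exp_zero, add_zero]
  field_simp
  ring

/-- Near `x` the increment dominates the linear function `m * t`, whose quotient tends to `m`; the
rest of the interval is negligible. -/
theorem eventually_lt_rightQuot {f : ℝ → ℝ} {x δ η m c : ℝ} (hδ : 0 < δ) (hη : 0 < η)
    (hf : IntervalIntegrable f volume x (x + δ))
    (hm : ∀ t, 0 ≤ t → t < η → t ≤ δ → m * t ≤ f (x + t) - f x) (hc : c < m) :
    ∀ᶠ s in atTop, c < rightQuot f x δ s := by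
  obtain ⟨θ, h0, hθη, hθδ⟩ : ∃ θ, 0 < θ ∧ θ < η ∧ θ ≤ δ :=
    ⟨min (η / 2) δ, lt_min (half_pos hη) hδ, (min_le_left _ _).trans_lt (half_lt_self hη),
      min_le_right _ _⟩
  have hlim := ((tendsto_sq_mul_integral_exp_mul_id h0).const_mul m).add
    (tendsto_rightQuot_sub h0 hθδ hf)
  rw [mul_one, add_zero] at hlim
  filter_upwards [hlim.eventually_const_lt hc] with s hs
  have hsub' : Set.uIcc 0 θ ⊆ Set.uIcc 0 δ := by
    rw [Set.uIcc_of_le h0.le, Set.uIcc_of_le hδ.le]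
    exact Set.Icc_subset_Icc_right hθδ
  have key : m * (s ^ 2 * ∫ t in (0 : ℝ)..θ, Real.exp (-(s * t)) * t) ≤ rightQuot f x θ s := by
    unfold rightQuot
    rw [mul_left_comm, ← intervalIntegral.integral_const_mul]
    refine mul_le_mul_of_nonneg_left ?_ (sq_nonneg s)
    refine intervalIntegral.integral_mono_on h0.le
      (Continuous.intervalIntegrable (by fun_prop) _ _)
      ((intervalIntegrable_exp_mul_sub hf s).mono_set hsub') fun t ht => ?_
    rw [mul_left_comm]
    exact mul_le_mul_of_nonneg_left (hm t ht.1 (ht.2.trans_lt hθη) (ht.2.trans hθδ))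
      (Real.exp_pos _).le
  linarith

theorem tendsto_rightQuot_of_hasDerivAt {f : ℝ → ℝ} {x δ d : ℝ} (hδ : 0 < δ)
    (hf : IntervalIntegrable f volume x (x + δ)) (hd : HasDerivAt f d x) :
    Tendsto (rightQuot f x δ) atTop (𝓝 d) := by
  have key : ∀ e > 0, ∃ η > 0, ∀ t, 0 ≤ t → t < η → |f (x + t) - f x - d * t| ≤ e * t := by
    intro e he
    obtain ⟨η, hη, h⟩ := Metric.eventually_nhds_iff.1 (hd.isLittleO.def he)
    refine ⟨η, hη, fun t ht htη => ?_⟩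
    have := @h (x + t) (by simpa [Real.dist_eq, abs_of_nonneg ht] using htη)
    simp only [add_sub_cancel_left, smul_eq_mul, Real.norm_eq_abs, abs_of_nonneg ht] at this
    rwa [mul_comm d]
  rw [tendsto_order]
  constructor
  · intro c hc
    obtain ⟨η, hη, h⟩ := key ((d - c) / 2) (by linarith)
    refine eventually_lt_rightQuot hδ hη hf (m := (d + c) / 2) (fun t ht htη _ => ?_) (by linarith)
    have := (abs_le.1 (h t ht htη)).1
    linarith
  · intro c hc
    obtain ⟨η, hη, h⟩ := key ((c - d) / 2) (by linarith)
    have := eventually_lt_rightQuot hδ hη (f := fun y => -f y) hf.neg (m := -((d + c) / 2))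
      (c := -c) (fun t ht htη _ => ?_) (by linarith)
    · filter_upwards [this] with s hs
      rw [rightQuot_neg] at hs
      linarith
    have := (abs_le.1 (h t ht htη)).2
    linarith

theorem tendsto_leftQuot_of_hasDerivAt {f : ℝ → ℝ} {x δ d : ℝ} (hδ : 0 < δ)
    (hf : IntervalIntegrable f volume (x - δ) x) (hd : HasDerivAt f d x) :
    Tendsto (leftQuot f x δ) atTop (𝓝 d) := by
  simp only [funext (leftQuot_eq_rightQuot f x δ)]
  refine tendsto_rightQuot_of_hasDerivAt hδ (intervalIntegrable_neg_comp_neg hf) ?_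
  rw [← neg_neg x] at hd
  have := (hd.comp (-x) (hasDerivAt_neg (-x))).neg
  rw [mul_neg_one, neg_neg] at this
  exact this

theorem hasLaplaceDerivAt_of_hasDerivAt {f : ℝ → ℝ} {x d : ℝ} (hf : Continuous f)
    (hd : HasDerivAt f d x) : HasLaplaceDerivAt f d x :=
  ⟨1, one_pos, hf.intervalIntegrable _ _,
    tendsto_rightQuot_of_hasDerivAt one_pos (hf.intervalIntegrable _ _) hd,
    tendsto_leftQuot_of_hasDerivAt one_pos (hf.intervalIntegrable _ _) hd⟩

theorem hasLaplaceDerivAt_of_tendsto {f : ℝ → ℝ} {x d δ₁ δ₂ : ℝ} (hf : Continuous f)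
    (h₁ : 0 < δ₁) (h₂ : 0 < δ₂) (hr : Tendsto (rightQuot f x δ₁) atTop (𝓝 d))
    (hl : Tendsto (leftQuot f x δ₂) atTop (𝓝 d)) : HasLaplaceDerivAt f d x :=
  ⟨min δ₁ δ₂, lt_min h₁ h₂, hf.intervalIntegrable _ _,
    (tendsto_rightQuot_congr (lt_min h₁ h₂) (min_le_left _ _) (hf.intervalIntegrable _ _)).1 hr,
    (tendsto_leftQuot_congr (lt_min h₁ h₂) (min_le_right _ _) (hf.intervalIntegrable _ _)).1 hl⟩

theorem HasLaplaceDerivAt.tendsto {f : ℝ → ℝ} {x d δ : ℝ} (hf : Continuous f)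
    (h : HasLaplaceDerivAt f d x) (hδ : 0 < δ) :
    Tendsto (rightQuot f x δ) atTop (𝓝 d) ∧ Tendsto (leftQuot f x δ) atTop (𝓝 d) := by
  obtain ⟨δ', h0, -, hr, hl⟩ := h
  rcases le_total δ δ' with h1 | h1
  · exact ⟨(tendsto_rightQuot_congr hδ h1 (hf.intervalIntegrable _ _)).1 hr,
      (tendsto_leftQuot_congr hδ h1 (hf.intervalIntegrable _ _)).1 hl⟩
  · exact ⟨(tendsto_rightQuot_congr h0 h1 (hf.intervalIntegrable _ _)).2 hr,
      (tendsto_leftQuot_congr h0 h1 (hf.intervalIntegrable _ _)).2 hl⟩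

/-! ## Major and minor functions -/

theorem isMinor_iff_neg {V f : ℝ → ℝ} {a b : ℝ} :
    IsMinor V f a b ↔ IsMajor (fun x => -V x) (fun x => -f x) a b := by
  constructor
  · rintro ⟨h1, h2, h3⟩
    refine ⟨h1.neg, fun x hx => ?_, fun x hx => ?_⟩
    · obtain ⟨δ, h0, hδ, h⟩ := h2 x hx
      refine ⟨δ, h0, hδ, coe_le_liminf_coe_iff.2 fun c hc => ?_⟩
      filter_upwards [limsup_coe_le_coe_iff.1 h (-c) (by linarith)] with s hs
      rw [rightQuot_neg]
      linarith
    · obtain ⟨δ, h0, hδ, h⟩ := h3 x hx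
      refine ⟨δ, h0, hδ, coe_le_liminf_coe_iff.2 fun c hc => ?_⟩
      filter_upwards [limsup_coe_le_coe_iff.1 h (-c) (by linarith)] with s hs
      rw [leftQuot_neg]
      linarith
  · rintro ⟨h1, h2, h3⟩
    refine ⟨h1.neg.congr fun x _ => (neg_neg (V x)).symm, fun x hx => ?_, fun x hx => ?_⟩
    · obtain ⟨δ, h0, hδ, h⟩ := h2 x hx
      refine ⟨δ, h0, hδ, limsup_coe_le_coe_iff.2 fun c hc => ?_⟩
      filter_upwards [coe_le_liminf_coe_iff.1 h (-c) (by linarith)] with s hs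
      rw [rightQuot_neg] at hs
      linarith
    · obtain ⟨δ, h0, hδ, h⟩ := h3 x hx
      refine ⟨δ, h0, hδ, limsup_coe_le_coe_iff.2 fun c hc => ?_⟩
      filter_upwards [coe_le_liminf_coe_iff.1 h (-c) (by linarith)] with s hs
      rw [leftQuot_neg] at hs
      linarith

theorem isMajor_of_forall_le_sub {U g : ℝ → ℝ} {a b : ℝ} (hU : ContinuousOn U (Set.Icc a b))
    (hr : ∀ x ∈ Set.Ico a b, ∃ η > 0, ∀ y, x ≤ y → y < x + η → y ≤ b →
      g x * (y - x) ≤ U y - U x)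
    (hl : ∀ x ∈ Set.Ioc a b, ∃ η > 0, ∀ y, y ≤ x → x - η < y → a ≤ y →
      g x * (x - y) ≤ U x - U y) : IsMajor U g a b := by
  refine ⟨hU, fun x hx => ?_, fun x hx => ?_⟩
  · obtain ⟨η, hη, h⟩ := hr x hx
    have hxb : x < b := hx.2
    refine ⟨b - x, by linarith, by linarith, coe_le_liminf_coe_iff.2 fun c hc => ?_⟩
    refine eventually_lt_rightQuot (by linarith) hη ?_ (fun t h0 h1 h2 => ?_) hc
    · refine (hU.mono ?_).intervalIntegrable
      rw [Set.uIcc_of_le (by linarith)]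
      exact Set.Icc_subset_Icc hx.1 (by linarith)
    · simpa using h (x + t) (by linarith) (by linarith) (by linarith)
  · obtain ⟨η, hη, h⟩ := hl x hx
    have hxb : a < x := hx.1
    refine ⟨x - a, by linarith, by linarith, coe_le_liminf_coe_iff.2 fun c hc => ?_⟩
    simp only [leftQuot_eq_rightQuot U]
    refine eventually_lt_rightQuot (by linarith) hη ?_ (fun t h0 h1 h2 => ?_) hc
    · refine intervalIntegrable_neg_comp_neg ((hU.mono ?_).intervalIntegrable)
      rw [Set.uIcc_of_le (by linarith)]
      exact Set.Icc_subset_Icc (by linarith) hx.2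
    · have := h (x - t) (by linarith) (by linarith) (by linarith)
      rw [neg_neg, show -(-x + t) = x - t by ring]
      rw [sub_sub_cancel] at this
      linarith

/-- If it failed, U - V + 3εy would attain its maximum at some x < b, where its right Laplace
quotients are nonpositive. The derivates of `U` and `V` at `x` make such a quotient positive for
large `s`. Only right derivates are used. -/
theorem IsMinor.sub_le_sub {U V g : ℝ → ℝ} {a b : ℝ} (hab : a ≤ b) (hV : IsMinor V g a b)
    (hU : IsMajor U g a b) : V b - V a ≤ U b - U a := by
  have key : ∀ ε > 0, V b - V a ≤ U b - U a + 3 * ε * (b - a) := by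
    intro ε hε
    by_contra! hlt
    have hab' : a < b := by
      rcases hab.eq_or_lt with h | h
      · subst h; simp at hlt
      · exact h
    obtain ⟨x, hx, hmax⟩ := isCompact_Icc.exists_isMaxOn (Set.nonempty_Icc.2 hab)
      (f := fun y => U y - V y + 3 * ε * y) ((hU.cont.sub hV.cont).add (by fun_prop))
    have hmax' : ∀ y ∈ Set.Icc a b, U y - V y + 3 * ε * y ≤ U x - V x + 3 * ε * x :=
      fun y hy => hmax hy
    -- By `hlt` the tilted difference is strictly smaller at `b` than at `a`.
    have hxb : x < b := by
      rcases hx.2.eq_or_lt with h | h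
      · have := hmax' a ⟨le_rfl, hab⟩
        subst h
        linarith
      · exact h
    obtain ⟨δ₁, h01, h1b, h1⟩ := hU.right x ⟨hx.1, hxb⟩
    obtain ⟨δ₂, h02, h2b, h2⟩ := hV.right x ⟨hx.1, hxb⟩
    have hi : ∀ {W : ℝ → ℝ} {δ : ℝ}, ContinuousOn W (Set.Icc a b) → 0 < δ → x + δ ≤ b →
        IntervalIntegrable W volume x (x + δ) := by
      intro W δ hW h0 h1
      refine (hW.mono ?_).intervalIntegrable
      rw [Set.uIcc_of_le (by linarith)]
      exact Set.Icc_subset_Icc hx.1 h1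
    set δ := min δ₁ δ₂
    have h0 : 0 < δ := lt_min h01 h02
    -- Four errors of ε/2 (two derivates, two changes of δ) total 2ε, while the tilt contributes
    -- more than 3ε · 2/3.
    have e1 := coe_le_liminf_coe_iff.1 h1 (g x - ε / 2) (by linarith)
    have e2 := limsup_coe_le_coe_iff.1 h2 (g x + ε / 2) (by linarith)
    have e3 := (tendsto_rightQuot_sub h0 (min_le_left δ₁ δ₂) (hi hU.cont h01 h1b)).eventually_lt_const
      (show 0 < ε / 2 by linarith)
    have e4 := (tendsto_rightQuot_sub h0 (min_le_right δ₁ δ₂)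
      (hi hV.cont h02 h2b)).eventually_const_lt (show -(ε / 2) < 0 by linarith)
    have e5 := (tendsto_sq_mul_integral_exp_mul_id h0).eventually_const_lt
      (show (2 / 3 : ℝ) < 1 by norm_num)
    obtain ⟨s, hs1, hs2, hs3, hs4, hs5⟩ :=
      (e1.and (e2.and (e3.and (e4.and e5)))).exists
    have hδb : x + δ ≤ b := by
      have := min_le_left δ₁ δ₂
      linarith
    have i1 := intervalIntegrable_exp_mul_sub (hi hU.cont h0 hδb) s
    have i2 := intervalIntegrable_exp_mul_sub (hi hV.cont h0 hδb) s
    have i3 : IntervalIntegrable (fun t => 3 * ε * (Real.exp (-(s * t)) * t)) volume 0 δ :=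
      Continuous.intervalIntegrable (by fun_prop) _ _
    have hle : rightQuot U x δ s - rightQuot V x δ s +
        3 * ε * (s ^ 2 * ∫ t in (0 : ℝ)..δ, Real.exp (-(s * t)) * t) ≤ 0 := by
      unfold rightQuot
      rw [mul_left_comm, ← mul_sub, ← mul_add, ← intervalIntegral.integral_const_mul,
        ← intervalIntegral.integral_sub i1 i2, ← intervalIntegral.integral_add (i1.sub i2) i3]
      refine mul_nonpos_of_nonneg_of_nonpos (sq_nonneg s) ?_
      rw [← neg_nonneg, ← intervalIntegral.integral_neg]
      refine intervalIntegral.integral_nonneg h0.le fun t ht => ?_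
      have := hmax' (x + t) ⟨by linarith [hx.1, ht.1], by linarith [ht.2]⟩
      have := mul_nonneg (Real.exp_pos (-(s * t))).le
        (show 0 ≤ -(U (x + t) - U x - (V (x + t) - V x) + 3 * ε * t) by linarith)
      linarith
    nlinarith
  refine le_of_forall_pos_le_add fun e he => ?_
  rcases hab.eq_or_lt with h | h
  · subst h; simpa using he.le
  · have h0 : 0 < b - a := by linarith
    have := key (e / (3 * (b - a))) (by positivity)
    have h3 : 3 * (e / (3 * (b - a))) * (b - a) = e := by field_simp
    linarith

theorem hasLaplaceIntegral_of_forall_exists {g : ℝ → ℝ} {a b A : ℝ} (hab : a ≤ b)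
    (hU : ∀ ε > 0, ∃ U, IsMajor U g a b ∧ U b - U a ≤ A + ε)
    (hV : ∀ ε > 0, ∃ V, IsMinor V g a b ∧ A - ε ≤ V b - V a) : HasLaplaceIntegral g a b A := by
  refine ⟨⟨?_, fun y hy => ?_⟩, ⟨?_, fun y hy => ?_⟩⟩
  · rintro y ⟨U, h, rfl⟩
    refine le_of_forall_pos_le_add fun e he => ?_
    obtain ⟨V, h1, h2⟩ := hV e he
    have := h1.sub_le_sub hab h
    linarith
  · refine le_of_forall_pos_le_add fun e he => ?_
    obtain ⟨U, h1, h2⟩ := hU e he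
    exact (hy ⟨U, h1, rfl⟩).trans h2
  · rintro y ⟨V, h, rfl⟩
    refine le_of_forall_pos_le_add fun e he => ?_
    obtain ⟨U, h1, h2⟩ := hU e he
    have := h.sub_le_sub hab h1
    linarith
  · refine le_of_forall_pos_le_add fun e he => ?_
    obtain ⟨V, h1, h2⟩ := hV e he
    have := hy ⟨V, h1, rfl⟩
    linarith

theorem hasLaplaceIntegral_of_hasLaplaceDerivAt {f φ : ℝ → ℝ} {a b : ℝ} (hab : a ≤ b)
    (hf : Continuous f) (h : ∀ x, HasLaplaceDerivAt f (φ x) x) :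
    HasLaplaceIntegral φ a b (f b - f a) := by
  have hmaj : IsMajor f φ a b := by
    refine ⟨hf.continuousOn, fun x hx => ?_, fun x hx => ?_⟩
    · exact ⟨b - x, sub_pos.2 hx.2, by linarith, coe_le_liminf_coe_iff.2 fun c hc =>
        ((h x).tendsto hf (sub_pos.2 hx.2)).1.eventually_const_lt hc⟩
    · exact ⟨x - a, sub_pos.2 hx.1, by linarith, coe_le_liminf_coe_iff.2 fun c hc =>
        ((h x).tendsto hf (sub_pos.2 hx.1)).2.eventually_const_lt hc⟩
  have hmin : IsMinor f φ a b := by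
    refine ⟨hf.continuousOn, fun x hx => ?_, fun x hx => ?_⟩
    · exact ⟨b - x, sub_pos.2 hx.2, by linarith, limsup_coe_le_coe_iff.2 fun c hc =>
        ((h x).tendsto hf (sub_pos.2 hx.2)).1.eventually_lt_const hc⟩
    · exact ⟨x - a, sub_pos.2 hx.1, by linarith, limsup_coe_le_coe_iff.2 fun c hc =>
        ((h x).tendsto hf (sub_pos.2 hx.1)).2.eventually_lt_const hc⟩
  exact hasLaplaceIntegral_of_forall_exists hab (fun ε hε => ⟨f, hmaj, by linarith⟩)
    (fun ε hε => ⟨f, hmin, by linarith⟩)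

/-! ## Riemann sums over fine partitions -/

/-- `S` is a Riemann sum of `g` over a `δ`-fine tagged partition of `[a, b]`. -/
inductive FineSum (g δ : ℝ → ℝ) : ℝ → ℝ → ℝ → Prop
  | nil (a : ℝ) : FineSum g δ a a 0
  | cons {u t v b S : ℝ} : u ≤ t → t ≤ v → t - δ t < u → v < t + δ t → FineSum g δ v b S →
      FineSum g δ u b (g t * (v - u) + S)

namespace FineSum

variable {g δ : ℝ → ℝ} {a b c S T : ℝ}

theorem le (h : FineSum g δ a b S) : a ≤ b := by
  induction h with
  | nil => exact le_rfl
  | cons h1 h2 _ _ _ ih => exact (h1.trans h2).trans ih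

theorem append (h : FineSum g δ a b S) (h' : FineSum g δ b c T) : FineSum g δ a c (S + T) := by
  induction h with
  | nil => simpa using h'
  | cons h1 h2 h3 h4 _ ih =>
    rw [add_assoc]
    exact cons h1 h2 h3 h4 (ih h')

theorem mono {δ' : ℝ → ℝ} (hle : ∀ t, δ t ≤ δ' t) (h : FineSum g δ a b S) :
    FineSum g δ' a b S := by
  induction h with
  | nil => exact nil _
  | @cons u t v _ _ h1 h2 h3 h4 _ ih =>
    exact cons h1 h2 (by linarith [hle t]) (by linarith [hle t]) ih

theorem single {t : ℝ} (h1 : a ≤ t) (h2 : t ≤ b) (h3 : t - δ t < a) (h4 : b < t + δ t) :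
    FineSum g δ a b (g t * (b - a)) := by
  simpa using cons (g := g) h1 h2 h3 h4 (nil b)

/-- Cousin's lemma. -/
theorem exists_of_pos (g : ℝ → ℝ) (hδ : ∀ t, 0 < δ t) (hab : a ≤ b) : ∃ S, FineSum g δ a b S := by
  set s := {x | x ≤ b ∧ ∃ S, FineSum g δ a x S} with hs
  have has : a ∈ s := ⟨hab, 0, nil a⟩
  have hbdd : BddAbove s := ⟨b, fun x hx => hx.1⟩
  set c := sSup s
  have hcb : c ≤ b := csSup_le ⟨a, has⟩ fun x hx => hx.1
  obtain ⟨y, hys, hy⟩ := exists_lt_of_lt_csSup ⟨a, has⟩ (sub_lt_self c (hδ c))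
  have hyc : y ≤ c := le_csSup hbdd hys
  obtain ⟨-, S, hS⟩ := hys
  have ext : ∀ z, c ≤ z → z < c + δ c → ∃ S, FineSum g δ a z S := fun z hz hz' =>
    ⟨_, hS.append (single hyc hz hy hz')⟩
  rcases hcb.eq_or_lt with h | h
  · exact ext b hcb (by linarith [hδ c])
  · obtain ⟨z, hcz, hz⟩ := exists_between (lt_min h (lt_add_of_pos_right c (hδ c)))
    have hzs : z ∈ s := ⟨(lt_min_iff.1 hz).1.le, ext z hcz.le (lt_min_iff.1 hz).2⟩
    exact absurd (le_csSup hbdd hzs) hcz.not_ge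

theorem comp_neg (h : FineSum (fun x => g (-x)) (fun x => δ (-x)) a b S) :
    FineSum g δ (-b) (-a) S := by
  induction h with
  | nil => exact nil _
  | @cons u t v b S h1 h2 h3 h4 _ ih =>
    have := ih.append (single (g := g) (δ := δ) (a := -v) (b := -u) (t := -t) (by linarith)
      (by linarith) (by linarith) (by linarith))
    rwa [show S + g (-t) * (-u - -v) = g (-t) * (v - u) + S by ring] at this

theorem neg (h : FineSum (fun x => -g x) δ a b S) : FineSum g δ a b (-S) := by
  induction h with
  | nil => simpa using nil (g := g) (δ := δ) _
  | @cons u t v b S h1 h2 h3 h4 _ ih =>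
    have := cons (g := g) h1 h2 h3 h4 ih
    rwa [show g t * (v - u) + -S = -(-g t * (v - u) + S) by ring] at this

theorem congr {g' : ℝ → ℝ} (h : FineSum g δ a b S) (hg : ∀ x, a ≤ x → x ≤ b → g x = g' x) :
    FineSum g' δ a b S := by
  induction h with
  | nil => exact nil _
  | @cons u t v b S h1 h2 h3 h4 hS ih =>
    rw [hg t h1 (h2.trans hS.le)]
    exact cons h1 h2 h3 h4 (ih fun x hx => hg x ((h1.trans h2).trans hx))

theorem eq_zero (h : FineSum g δ a b S) (hg : ∀ x, a ≤ x → x ≤ b → g x = 0) : S = 0 := by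
  induction h with
  | nil => rfl
  | @cons u t v b S h1 h2 h3 h4 hS ih =>
    rw [hg t h1 (h2.trans hS.le), ih fun x hx => hg x ((h1.trans h2).trans hx)]
    ring

theorem exists_isFinePartition (h : FineSum g δ a b S) :
    ∃ (n : ℕ) (x ξ : ℕ → ℝ), IsFinePartition δ a b n x ξ ∧ riemannSum g n x ξ = S := by
  induction h with
  | nil a => exact ⟨0, fun _ => a, fun _ => a, ⟨rfl, rfl, by simp⟩, by simp [riemannSum]⟩
  | @cons u t v b S h1 h2 h3 h4 hS ih =>
    obtain ⟨n, x, ξ, ⟨hx0, hxn, hx⟩, rfl⟩ := ih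
    refine ⟨n + 1, fun i => i.casesOn u x, fun i => i.casesOn t ξ, ⟨rfl, hxn, ?_⟩, ?_⟩
    · intro i hi
      cases i with
      | zero => exact ⟨h1, by simpa [hx0] using h2, h3, by simpa [hx0] using h4⟩
      | succ i => exact hx i (by omega)
    · unfold riemannSum
      rw [Finset.sum_range_succ', add_comm]
      simp [hx0]

theorem of_isFinePartition {n : ℕ} {x ξ : ℕ → ℝ} (h : IsFinePartition δ a b n x ξ) :
    FineSum g δ a b (riemannSum g n x ξ) := by
  induction n generalizing x ξ a with
  | zero =>
    obtain ⟨rfl, rfl, -⟩ := h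
    simpa [riemannSum] using nil (g := g) (δ := δ) _
  | succ n ih =>
    obtain ⟨rfl, h1, h2⟩ := h
    have h3 := h2 0 n.succ_pos
    have := ih (a := x 1) (x := fun i => x (i + 1)) (ξ := fun i => ξ (i + 1))
      ⟨rfl, h1, fun i hi => h2 (i + 1) (by omega)⟩
    have h4 := cons h3.1 h3.2.1 h3.2.2.1 h3.2.2.2 this
    convert h4 using 1
    unfold riemannSum
    rw [Finset.sum_range_succ', add_comm]

end FineSum

theorem hasHKIntegral_iff {g : ℝ → ℝ} {a b A : ℝ} :
    HasHKIntegral g a b A ↔ ∀ ε > 0, ∃ δ : ℝ → ℝ, (∀ t, 0 < δ t) ∧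
      ∀ S, FineSum g δ a b S → |S - A| < ε := by
  refine forall₂_congr fun ε hε => exists_congr fun δ => and_congr_right fun hδ => ⟨?_, ?_⟩
  · intro h S hS
    obtain ⟨n, x, ξ, hp, rfl⟩ := hS.exists_isFinePartition
    exact h n x ξ hp
  · exact fun h n x ξ hp => h _ (.of_isFinePartition hp)

theorem hasHKIntegralReal_iff {g : ℝ → ℝ} {A : ℝ} :
    HasHKIntegralReal g A ↔ ∀ ε > 0, ∃ (δ : ℝ → ℝ) (r : ℝ), (∀ t, 0 < δ t) ∧ 0 < r ∧
      ∀ u v, u < -r → r < v → ∀ S, FineSum g δ u v S → |S - A| < ε := by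
  refine forall₂_congr fun ε hε => exists₂_congr fun δ r => and_congr_right fun hδ =>
    and_congr_right fun hr => forall₄_congr fun u v hu hv => ⟨?_, ?_⟩
  · intro h S hS
    obtain ⟨n, x, ξ, hp, rfl⟩ := hS.exists_isFinePartition
    exact h n x ξ hp
  · exact fun h n x ξ hp => h _ (.of_isFinePartition hp)

/-! ## Primitives of Henstock–Kurzweil integrable functions -/

/-- The Henstock–Kurzweil upper integral of `g` over `[u, v]`. -/
noncomputable def hkInt (g : ℝ → ℝ) (u v : ℝ) : ℝ :=
  sInf {y | ∃ δ : ℝ → ℝ, (∀ t, 0 < δ t) ∧ ∀ S, FineSum g δ u v S → S ≤ y}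

/-- The Cauchy criterion for Henstock–Kurzweil integrability. -/
def HKCauchy (g : ℝ → ℝ) (a b : ℝ) : Prop :=
  ∀ ε > 0, ∃ δ : ℝ → ℝ, (∀ t, 0 < δ t) ∧
    ∀ S S', FineSum g δ a b S → FineSum g δ a b S' → |S - S'| ≤ ε

/-- `F` is a primitive of `g` on `[a, b]`: Riemann sums of `g` approximate the increments of `F`
uniformly over the subintervals of `[a, b]`. -/
def IsHKPrimitive (g F : ℝ → ℝ) (a b : ℝ) : Prop :=
  ∀ ε > 0, ∃ δ : ℝ → ℝ, (∀ t, 0 < δ t) ∧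
    ∀ c d S, a ≤ c → d ≤ b → FineSum g δ c d S → |S - (F d - F c)| ≤ ε

section

variable {g F δ : ℝ → ℝ} {a b c d ε : ℝ}

/-- Fine sums for `δ` and for any competing gauge share a common refinement by Cousin's lemma, so S
- ε bounds from below the set whose infimum is taken, and S + ε belongs to it. -/
theorem abs_sub_hkInt_le (hδ : ∀ t, 0 < δ t)
    (h : ∀ S S', FineSum g δ a b S → FineSum g δ a b S' → |S - S'| ≤ ε) {S : ℝ}
    (hS : FineSum g δ a b S) : |S - hkInt g a b| ≤ ε := by
  have hmem : S + ε ∈ {y | ∃ δ : ℝ → ℝ, (∀ t, 0 < δ t) ∧ ∀ S, FineSum g δ a b S → S ≤ y} :=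
    ⟨δ, hδ, fun S' hS' => by linarith [(abs_le.1 (h S S' hS hS')).1]⟩
  have hlow : S - ε ∈ lowerBounds
      {y | ∃ δ : ℝ → ℝ, (∀ t, 0 < δ t) ∧ ∀ S, FineSum g δ a b S → S ≤ y} := by
    rintro y ⟨δ', hδ', hy⟩
    obtain ⟨T, hT⟩ := FineSum.exists_of_pos g (fun t => lt_min (hδ t) (hδ' t)) hS.le
    have h1 := hy T (hT.mono fun t => min_le_right _ _)
    have h2 := h S T hS (hT.mono fun t => min_le_left _ _)
    linarith [(abs_le.1 h2).2]
  have h1 := csInf_le ⟨_, hlow⟩ hmem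
  have h2 := le_csInf ⟨_, hmem⟩ hlow
  unfold hkInt
  rw [abs_le]
  constructor <;> linarith

/-- Completing both sums by the same fine sums on [a, c] and [d, b] leaves their difference
unchanged. -/
theorem abs_sub_le_of_subinterval (hδ : ∀ t, 0 < δ t)
    (h : ∀ S S', FineSum g δ a b S → FineSum g δ a b S' → |S - S'| ≤ ε) (hac : a ≤ c)
    (hdb : d ≤ b) (S S' : ℝ) (hS : FineSum g δ c d S) (hS' : FineSum g δ c d S') :
    |S - S'| ≤ ε := by
  obtain ⟨T, hT⟩ := FineSum.exists_of_pos g hδ hac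
  obtain ⟨T', hT'⟩ := FineSum.exists_of_pos g hδ hdb
  have := h _ _ (hT.append (hS.append hT')) (hT.append (hS'.append hT'))
  rwa [show T + (S + T') - (T + (S' + T')) = S - S' by ring] at this

theorem HKCauchy.hkInt_add (h : HKCauchy g a b) (hac : a ≤ c) (hcd : c ≤ d) (hdb : d ≤ b) :
    hkInt g a c + hkInt g c d = hkInt g a d := by
  have key : ∀ ε > 0, |hkInt g a c + hkInt g c d - hkInt g a d| ≤ 3 * ε := by
    intro ε hε
    obtain ⟨δ, hδ, h⟩ := h ε hε
    obtain ⟨S, hS⟩ := FineSum.exists_of_pos g hδ hac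
    obtain ⟨T, hT⟩ := FineSum.exists_of_pos g hδ hcd
    have h1 := abs_le.1 <| abs_sub_hkInt_le hδ
      (abs_sub_le_of_subinterval hδ h le_rfl (hcd.trans hdb)) hS
    have h2 := abs_le.1 <| abs_sub_hkInt_le hδ (abs_sub_le_of_subinterval hδ h hac hdb) hT
    have h3 := abs_le.1 <| abs_sub_hkInt_le hδ
      (abs_sub_le_of_subinterval hδ h le_rfl hdb) (hS.append hT)
    rw [abs_le]
    constructor <;> linarith
  refine sub_eq_zero.1 (abs_nonpos_iff.1 (le_of_forall_pos_le_add fun e he => ?_))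
  have := key (e / 3) (by positivity)
  linarith

theorem HKCauchy.isHKPrimitive (h : HKCauchy g a b) : IsHKPrimitive g (hkInt g a) a b := by
  intro ε hε
  obtain ⟨δ, hδ, h'⟩ := h ε hε
  refine ⟨δ, hδ, fun c d S hac hdb hS => ?_⟩
  have h1 := abs_sub_hkInt_le hδ (abs_sub_le_of_subinterval hδ h' hac hdb) hS
  rwa [← h.hkInt_add hac hS.le hdb, add_sub_cancel_left]

theorem HasHKIntegral.hkCauchy {A : ℝ} (h : HasHKIntegral g a b A) : HKCauchy g a b := by
  intro ε hε
  obtain ⟨δ, hδ, h⟩ := hasHKIntegral_iff.1 h (ε / 2) (by linarith)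
  refine ⟨δ, hδ, fun S S' hS hS' => ?_⟩
  have h1 := abs_lt.1 (h S hS)
  have h2 := abs_lt.1 (h S' hS')
  rw [abs_le]
  constructor <;> linarith

theorem HasHKIntegralReal.hkCauchy {A : ℝ} (h : HasHKIntegralReal g A) (a b : ℝ) :
    HKCauchy g a b := by
  intro ε hε
  obtain ⟨δ, r, hδ, hr, h⟩ := hasHKIntegralReal_iff.1 h (ε / 2) (by linarith)
  -- The interval is enlarged past ±r, where the criterion on the line applies, and then restricted.
  refine ⟨δ, hδ, abs_sub_le_of_subinterval hδ (a := min a (-r - 1)) (b := max b (r + 1))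
    (fun S S' hS hS' => ?_) (min_le_left _ _) (le_max_left _ _)⟩
  have hu : min a (-r - 1) < -r := (min_le_right _ _).trans_lt (by linarith)
  have hv : r < max b (r + 1) := (le_max_right _ _).trans_lt' (by linarith)
  have h1 := abs_lt.1 (h _ _ hu hv S hS)
  have h2 := abs_lt.1 (h _ _ hu hv S' hS')
  rw [abs_le]
  constructor <;> linarith

theorem IsHKPrimitive.mono (h : IsHKPrimitive g F a b) (hac : a ≤ c) (hdb : d ≤ b) :
    IsHKPrimitive g F c d := by
  intro ε hε
  obtain ⟨δ, hδ, h⟩ := h ε hε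
  exact ⟨δ, hδ, fun c' d' S h1 h2 => h c' d' S (hac.trans h1) (h2.trans hdb)⟩

theorem IsHKPrimitive.neg (h : IsHKPrimitive g F a b) :
    IsHKPrimitive (fun x => -g x) (fun x => -F x) a b := by
  intro ε hε
  obtain ⟨δ, hδ, h⟩ := h ε hε
  refine ⟨δ, hδ, fun c d S h1 h2 hS => ?_⟩
  rw [← abs_neg]
  convert h c d _ h1 h2 hS.neg using 2
  ring

theorem IsHKPrimitive.comp_neg (h : IsHKPrimitive g F a b) :
    IsHKPrimitive (fun x => g (-x)) (fun x => -F (-x)) (-b) (-a) := by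
  intro ε hε
  obtain ⟨δ, hδ, h⟩ := h ε hε
  refine ⟨fun x => δ (-x), fun t => hδ (-t), fun c d S h1 h2 hS => ?_⟩
  convert h (-d) (-c) S (by linarith) (by linarith) hS.comp_neg using 2
  ring

/-- Compare the increment of `F` with the fine sum of the single interval between `x` and `y`,
tagged at `x`. -/
theorem IsHKPrimitive.continuousOn (h : IsHKPrimitive g F a b) :
    ContinuousOn F (Set.Icc a b) := by
  intro x hx
  rw [Metric.continuousWithinAt_iff]
  intro ε hε
  obtain ⟨δ, hδ, h⟩ := h (ε / 2) (by linarith)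
  refine ⟨min (δ x) (ε / 2 / (|g x| + 1)), lt_min (hδ x) (by positivity), fun y hy hyx => ?_⟩
  rw [Real.dist_eq, lt_min_iff] at hyx
  rw [Real.dist_eq]
  have h1 : |g x| * |y - x| < ε / 2 := by
    have h2 := (lt_div_iff₀ (by positivity)).1 hyx.2
    nlinarith [abs_nonneg (y - x)]
  rw [← abs_mul] at h1
  have h1' := abs_lt.1 h1
  have h3 := abs_lt.1 hyx.1
  rcases le_total x y with hxy | hxy
  · have := abs_le.1 <| h x y _ hx.1 hy.2
      (FineSum.single le_rfl hxy (by linarith [hδ x]) (by linarith))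
    rw [abs_lt]
    constructor <;> linarith
  · have := abs_le.1 <| h y x _ hy.1 hx.2
      (FineSum.single (δ := δ) hxy le_rfl (by linarith) (by linarith [hδ x]))
    rw [abs_lt]
    constructor <;> linarith

end

/-! ## Partial sums over left-tagged intervals -/

/-- `S` is the sum of `k u v` over finitely many nonoverlapping intervals `[u, v]` in `[a, b]`
satisfying `D u v`. -/
inductive PartialSum (D : ℝ → ℝ → Prop) (k : ℝ → ℝ → ℝ) : ℝ → ℝ → ℝ → Prop
  | nil (a : ℝ) : PartialSum D k a a 0
  | skip {u v b S : ℝ} : u ≤ v → PartialSum D k v b S → PartialSum D k u b S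
  | cons {u v b S : ℝ} : u ≤ v → D u v → PartialSum D k v b S → PartialSum D k u b (k u v + S)

namespace PartialSum

variable {D : ℝ → ℝ → Prop} {k : ℝ → ℝ → ℝ} {a b c S T : ℝ}

theorem le (h : PartialSum D k a b S) : a ≤ b := by
  induction h with
  | nil => exact le_rfl
  | skip h1 _ ih => exact h1.trans ih
  | cons h1 _ _ ih => exact h1.trans ih

theorem append (h : PartialSum D k a b S) (h' : PartialSum D k b c T) :
    PartialSum D k a c (S + T) := by
  induction h with
  | nil => simpa using h'
  | skip h1 _ ih => exact skip h1 (ih h')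
  | cons h1 h2 _ ih =>
    rw [add_assoc]
    exact cons h1 h2 (ih h')

theorem zero (hab : a ≤ b) : PartialSum D k a b 0 := skip hab (nil b)

theorem single (hab : a ≤ b) (h : D a b) : PartialSum D k a b (k a b) := by
  simpa using cons hab h (nil b)

/-- Henstock's lemma. -/
theorem exists_fineSum {g F δ : ℝ → ℝ} {c d : ℝ} (hδ : ∀ t, 0 < δ t) (hF : IsHKPrimitive g F a b)
    (hD : ∀ u v, D u v → v < u + δ u) (hk : ∀ u v, k u v = g u * (v - u) - (F v - F u))
    (h : PartialSum D k c d S) (hac : a ≤ c) (hdb : d ≤ b) {η : ℝ} (hη : 0 < η) :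
    ∃ T, FineSum g δ c d T ∧ |T - (F d - F c) - S| ≤ η := by
  induction h generalizing η with
  | nil => exact ⟨0, .nil _, by simpa using hη.le⟩
  | @skip u v d S h1 h2 ih =>
    -- A skipped interval is filled by a sum that is also fine for a gauge of accuracy η/2; the
    -- other half of η is left for the remaining gaps.
    obtain ⟨δ', hδ', h'⟩ := hF (η / 2) (half_pos hη)
    obtain ⟨T', hT'⟩ := FineSum.exists_of_pos g (fun t => lt_min (hδ t) (hδ' t)) h1
    obtain ⟨T, hT, hT2⟩ := ih (hac.trans h1) hdb (half_pos hη)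
    refine ⟨T' + T, (hT'.mono fun t => min_le_left _ _).append hT, ?_⟩
    have h3 := abs_le.1 <| h' u v T' hac (h2.le.trans hdb) (hT'.mono fun t => min_le_right _ _)
    have h4 := abs_le.1 hT2
    rw [abs_le]
    constructor <;> linarith
  | @cons u v d S h1 hd h2 ih =>
    obtain ⟨T, hT, hT2⟩ := ih (hac.trans h1) hdb hη
    refine ⟨_, .cons le_rfl h1 (by linarith [hδ u]) (hD u v hd) hT, ?_⟩
    rw [hk]
    convert hT2 using 2
    ring

/-- The skipped intervals can be filled with arbitrarily small error, so the bound for full fine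
sums passes to partial sums without loss. -/
theorem abs_le_of_fineSum {g F δ : ℝ → ℝ} {ε c d : ℝ} (hδ : ∀ t, 0 < δ t)
    (hF : IsHKPrimitive g F a b)
    (hε : ∀ c d S, a ≤ c → d ≤ b → FineSum g δ c d S → |S - (F d - F c)| ≤ ε)
    (hD : ∀ u v, D u v → v < u + δ u) (hk : ∀ u v, k u v = g u * (v - u) - (F v - F u))
    (h : PartialSum D k c d S) (hac : a ≤ c) (hdb : d ≤ b) : |S| ≤ ε := by
  refine le_of_forall_pos_le_add fun η hη => ?_
  obtain ⟨T, hT, hT'⟩ := h.exists_fineSum hδ hF hD hk hac hdb hη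
  have h1 := abs_le.1 (hε c d T hac hdb hT)
  have h2 := abs_le.1 hT'
  rw [abs_le]
  constructor <;> linarith

end PartialSum

/-! ### Cutting partial sums at a point -/

namespace PartialSum

variable {D : ℝ → ℝ → Prop} {k : ℝ → ℝ → ℝ} {x y S η : ℝ}

theorem eq_zero_of_eq (hk : ∀ u, k u u = 0) (h : PartialSum D k x y S) (hxy : x = y) : S = 0 := by
  induction h with
  | nil => rfl
  | skip h1 h2 ih => exact ih (le_antisymm h2.le (hxy ▸ h1))
  | @cons u v b S h1 _ h2 ih =>
    obtain rfl : v = b := le_antisymm h2.le (hxy ▸ h1)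
    rw [ih rfl, hxy, hk, add_zero]

/-- An interval straddling `x` is shortened to end at `x`, at a cost of at most η; at most one
interval is affected. -/
theorem exists_split (hD : ∀ u v v', D u v → u ≤ v' → v' ≤ v → D u v') {a : ℝ} (hη : 0 ≤ η)
    (h : PartialSum D k a y S) (hax : a ≤ x) (hxy : x ≤ y)
    (hω : ∀ t v, D t v → x ≤ v → v ≤ y → k t v - k t x ≤ η) :
    ∃ S₁ S₂, PartialSum D k a x S₁ ∧ PartialSum D k x y S₂ ∧ S ≤ S₁ + S₂ + η := by
  induction h with
  | nil a =>
    obtain rfl := le_antisymm hax hxy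
    exact ⟨0, 0, nil _, nil _, by simpa using hη⟩
  | @skip u v b S h1 h2 ih =>
    rcases le_total v x with hv | hv
    · obtain ⟨S₁, S₂, h3, h4, h5⟩ := ih hv hxy hω
      exact ⟨S₁, S₂, skip h1 h3, h4, h5⟩
    · exact ⟨0, S, zero hax, skip hv h2, by linarith⟩
  | @cons u v b S h1 hd h2 ih =>
    rcases le_total v x with hv | hv
    · obtain ⟨S₁, S₂, h3, h4, h5⟩ := ih hv hxy hω
      exact ⟨_, S₂, cons h1 hd h3, h4, by linarith⟩
    · exact ⟨_, S, single hax (hD u v x hd hax hv), skip hv h2,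
        by linarith [hω u v hd hv h2.le]⟩

/-- Dropping a nondegenerate interval that starts at `x` moves the sum strictly to the right of `x`,
where it can be compared with the right limit of the supremum function. -/
theorem exists_drop_head (hk : ∀ u, k u u = 0) (hη : 0 ≤ η) (h : PartialSum D k x y S)
    (hxy : x < y) (hω : ∀ v, D x v → x ≤ v → v ≤ y → k x v ≤ η) :
    ∃ x' S', x < x' ∧ PartialSum D k x' y S' ∧ S ≤ S' + η := by
  induction h with
  | nil a => exact absurd hxy (lt_irrefl _)
  | @skip u v b S h1 h2 ih =>
    rcases h1.eq_or_lt with rfl | h1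
    · exact ih hxy hω
    · exact ⟨v, S, h1, h2, by linarith⟩
  | @cons u v b S h1 hd h2 ih =>
    rcases h1.eq_or_lt with rfl | h3
    · rw [hk, zero_add]
      exact ih hxy hω
    · exact ⟨v, S, h3, h2, by linarith [hω v hd h1 h2.le]⟩

/-- Only an interval reaching `y` has to be shortened. This serves left continuity, as a nearly
optimal sum up to `y` yields one up to every nearby x' < y. -/
theorem exists_truncate (hk : ∀ u, k u u = 0) (hD : ∀ u v v', D u v → u ≤ v' → v' ≤ v → D u v')
    (hη : 0 ≤ η) {a x₁ : ℝ} (h : PartialSum D k a y S) (hay : a < y) (hx₁ : x₁ < y)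
    (hω : ∀ t v, D t y → x₁ ≤ v → v ≤ y → k t y - k t v ≤ η) :
    ∃ x₀, a ≤ x₀ ∧ x₀ < y ∧
      ∀ x', x₀ ≤ x' → x' ≤ y → ∃ S', PartialSum D k a x' S' ∧ S ≤ S' + η := by
  induction h with
  | nil a => exact absurd hay (lt_irrefl _)
  | @skip u v b S h1 h2 ih =>
    rcases h2.le.eq_or_lt with rfl | h3
    · refine ⟨u, le_rfl, hay, fun x' hx' _ => ⟨0, zero hx', ?_⟩⟩
      rw [h2.eq_zero_of_eq hk rfl, zero_add]
      exact hη
    · obtain ⟨x₀, h4, h5, h6⟩ := ih h3 hx₁ hω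
      refine ⟨x₀, h1.trans h4, h5, fun x' hx' hx'' => ?_⟩
      obtain ⟨S', h7, h8⟩ := h6 x' hx' hx''
      exact ⟨S', skip h1 h7, h8⟩
  | @cons u v b S h1 hd h2 ih =>
    rcases h2.le.eq_or_lt with rfl | h3
    · refine ⟨max u x₁, le_max_left _ _, max_lt hay hx₁, fun x' hx' hx'' => ⟨k u x',
        single ((le_max_left _ _).trans hx') (hD u v x' hd ((le_max_left _ _).trans hx') hx''), ?_⟩⟩
      rw [h2.eq_zero_of_eq hk rfl]
      linarith [hω u x' hd ((le_max_right _ _).trans hx') hx'']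
    · obtain ⟨x₀, h4, h5, h6⟩ := ih h3 hx₁ hω
      refine ⟨x₀, h1.trans h4, h5, fun x' hx' hx'' => ?_⟩
      obtain ⟨S', h7, h8⟩ := h6 x' hx' hx''
      exact ⟨_, cons h1 hd h7, by linarith⟩

end PartialSum

/-! ## Continuous major functions of Henstock–Kurzweil integrable functions -/

section

variable {g F : ℝ → ℝ} {a b : ℝ}

/-- `H x` is the supremum of partial Henstock errors over [a, x] with left tags in `E`. Henstock's
lemma bounds it by ε, and appending one more interval gives the increment inequality. Boundedness of
`g` on `E` and continuity of `F` make the effect of shortening an interval small uniformly in its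
tag, whence continuity. -/
theorem IsHKPrimitive.exists_continuousOn_of_bounded (hF : IsHKPrimitive g F a b) {E : Set ℝ}
    {N : ℝ} (hE : ∀ x ∈ E, |g x| ≤ N) {ε : ℝ} (hε : 0 < ε) :
    ∃ H : ℝ → ℝ, ContinuousOn H (Set.Icc a b) ∧ MonotoneOn H (Set.Icc a b) ∧
      (∀ x ∈ Set.Icc a b, 0 ≤ H x ∧ H x ≤ ε) ∧
      ∀ x ∈ E, a ≤ x → ∃ η > 0, ∀ y, x ≤ y → y < x + η → y ≤ b →
        g x * (y - x) - (F y - F x) ≤ H y - H x := by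
  obtain ⟨δ, hδ, hS⟩ := hF ε hε
  set D : ℝ → ℝ → Prop := fun u v => u ∈ E ∧ v < u + δ u with hDdef
  set k : ℝ → ℝ → ℝ := fun u v => g u * (v - u) - (F v - F u) with hkdef
  have hD : ∀ u v v', D u v → u ≤ v' → v' ≤ v → D u v' := fun u v v' h _ h' =>
    ⟨h.1, h'.trans_lt h.2⟩
  have hk : ∀ u, k u u = 0 := fun u => by simp [hkdef]
  set H : ℝ → ℝ := fun x => sSup {S | PartialSum D k a x S} with hH
  have hbd : ∀ {x S}, x ≤ b → PartialSum D k a x S → S ≤ ε := fun hx h =>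
    (le_abs_self _).trans (h.abs_le_of_fineSum hδ hF hS (fun u v h => h.2) (fun _ _ => rfl) le_rfl hx)
  have hle : ∀ {x S}, x ≤ b → PartialSum D k a x S → S ≤ H x := fun hx h =>
    le_csSup ⟨ε, fun T hT => hbd hx hT⟩ h
  have hHle : ∀ {x c}, a ≤ x → (∀ S, PartialSum D k a x S → S ≤ c) → H x ≤ c := fun hx h =>
    csSup_le ⟨0, .zero hx⟩ h
  have hadd : ∀ {x y T}, a ≤ x → y ≤ b → PartialSum D k x y T → H x + T ≤ H y := by
    intro x y T hx hy hT
    rw [← le_sub_iff_add_le]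
    refine hHle hx fun S hS => ?_
    rw [le_sub_iff_add_le]
    exact hle hy (hS.append hT)
  have hmono : MonotoneOn H (Set.Icc a b) := by
    intro x hx y hy hxy
    simpa using hadd hx.1 hy.2 (.zero (D := D) (k := k) hxy)
  have hFc := hF.continuousOn
  have hω : ∀ x ∈ Set.Icc a b, ∀ η > 0, ∃ ρ > 0, ∀ u v, u ∈ Set.Icc a b → v ∈ Set.Icc a b → u ≤ v →
      |u - x| < ρ → |v - x| < ρ → ∀ t ∈ E, k t v - k t u ≤ η := by
    intro x hx η hη
    obtain ⟨ρ₁, hρ₁, h1⟩ := Metric.continuousWithinAt_iff.1 (hFc x hx) (η / 4) (by linarith)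
    -- The increment of `F` and the term in `g` each receive η/2.
    refine ⟨min ρ₁ (η / (4 * (|N| + 1))), lt_min hρ₁ (by positivity),
      fun u v hu hv huv hux hvx t ht => ?_⟩
    rw [lt_min_iff] at hux hvx
    have h2 := abs_lt.1 (h1 hu hux.1)
    have h3 := abs_lt.1 (h1 hv hvx.1)
    have h4 : v - u ≤ 2 * (η / (4 * (|N| + 1))) := by
      have := abs_lt.1 hux.2
      have := abs_lt.1 hvx.2
      linarith
    have h5 : g t * (v - u) ≤ η / 2 := by
      calc g t * (v - u) ≤ (|N| + 1) * (v - u) :=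
            mul_le_mul_of_nonneg_right
              (by linarith [le_abs_self (g t), hE t ht, le_abs_self N]) (by linarith)
        _ ≤ (|N| + 1) * (2 * (η / (4 * (|N| + 1)))) := by gcongr
        _ = η / 2 := by field_simp; norm_num
    have : k t v - k t u = g t * (v - u) - (F v - F u) := by simp only [hkdef]; ring
    linarith
  refine ⟨H, ?_, hmono, fun x hx => ⟨hle hx.2 (.zero hx.1), hHle hx.1 fun S => hbd hx.2⟩, ?_⟩
  · intro x hx
    have hright : ∀ η > 0, ∃ ρ > 0, ∀ y ∈ Set.Icc a b, x < y → y < x + ρ → H y ≤ H x + 3 * η := by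
      intro η hη
      rcases hx.2.eq_or_lt with h | hxb
      · exact ⟨1, one_pos, fun y hy hxy _ => absurd hy.2 (by linarith)⟩
      obtain ⟨ρ, hρ, hω⟩ := hω x hx η hη
      -- `L` is the right limit of the monotone function `H` at `x`. A partial sum starting at x' >
      -- x is at most H y - H x' < η, because H x' ≥ L and H y < L + η; splitting and dropping the
      -- head cost another 2η.
      set L := sInf (H '' Set.Ioc x b)
      have hLbd : BddBelow (H '' Set.Ioc x b) := by
        refine ⟨H x, ?_⟩
        rintro _ ⟨y, hy, rfl⟩
        exact hmono hx ⟨hx.1.trans hy.1.le, hy.2⟩ hy.1.le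
      obtain ⟨_, ⟨y₀, hy₀, rfl⟩, hy₀'⟩ := exists_lt_of_csInf_lt
        (s := H '' Set.Ioc x b) ⟨_, b, ⟨hxb, le_rfl⟩, rfl⟩ (lt_add_of_pos_right L hη)
      refine ⟨min ρ (y₀ - x), lt_min hρ (sub_pos.2 hy₀.1), fun y hy hxy hyρ => ?_⟩
      have hy1 : y < x + ρ := by linarith [min_le_left ρ (y₀ - x)]
      have hy2 : y < y₀ := by linarith [min_le_right ρ (y₀ - x)]
      have hω' : ∀ t ∈ E, ∀ v, x ≤ v → v ≤ y → k t v - k t x ≤ η := fun t ht v hv hv' =>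
        hω x v hx ⟨hx.1.trans hv, hv'.trans hy.2⟩ hv (by simpa using hρ)
          (by rw [abs_of_nonneg (by linarith)]; linarith) t ht
      refine hHle hy.1 fun S hS => ?_
      obtain ⟨S₁, S₂, h1, h2, h3⟩ := hS.exists_split hD hη.le hx.1 hxy.le
        fun t v htv => hω' t htv.1 v
      obtain ⟨x', S', h4, h5, h6⟩ := h2.exists_drop_head hk hη.le hxy fun v hv h h' => by
        simpa [hk] using hω' x hv.1 v h h'
      have h7 := hadd (hx.1.trans h4.le) hy.2 h5
      have h8 : L ≤ H x' := csInf_le hLbd ⟨x', ⟨h4, h5.le.trans hy.2⟩, rfl⟩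
      have h9 := hmono hy ⟨hx.1.trans hy₀.1.le, hy₀.2⟩ hy2.le
      have h10 := hle hx.2 h1
      linarith
    have hleft : ∀ η > 0, ∃ ρ > 0, ∀ y ∈ Set.Icc a b, y < x → x - ρ < y → H x ≤ H y + 3 * η := by
      intro η hη
      rcases hx.1.eq_or_lt with h | hax
      · exact ⟨1, one_pos, fun y hy hxy _ => absurd hy.1 (by linarith)⟩
      obtain ⟨ρ, hρ, hω⟩ := hω x hx η hη
      obtain ⟨S, hS, hS'⟩ := exists_lt_of_lt_csSup (s := {S | PartialSum D k a x S})
        ⟨0, .zero hx.1⟩ (sub_lt_self (H x) hη)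
      obtain ⟨x₀, h1, h2, h3⟩ := hS.exists_truncate hk hD hη.le hax (x₁ := max a (x - ρ / 2))
        (max_lt hax (by linarith)) fun t v htv hv hv' => by
          have hv1 := (le_max_left _ _).trans hv
          have hv2 := (le_max_right _ _).trans hv
          exact hω v x ⟨hv1, hv'.trans hx.2⟩ hx hv'
            (by rw [abs_of_nonpos (by linarith)]; linarith) (by simpa using hρ) t htv.1
      refine ⟨x - x₀, by linarith, fun y hy hyx hyρ => ?_⟩
      obtain ⟨S', h4, h5⟩ := h3 y (by linarith) hyx.le
      have := hle hy.2 h4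
      linarith
    rw [Metric.continuousWithinAt_iff]
    intro e he
    obtain ⟨ρ₁, hρ₁, h1⟩ := hright (e / 4) (by linarith)
    obtain ⟨ρ₂, hρ₂, h2⟩ := hleft (e / 4) (by linarith)
    refine ⟨min ρ₁ ρ₂, lt_min hρ₁ hρ₂, fun y hy hyx => ?_⟩
    rw [Real.dist_eq, lt_min_iff, abs_lt, abs_lt] at hyx
    rw [Real.dist_eq, abs_lt]
    rcases lt_trichotomy x y with h | rfl | h
    · have := hmono hx hy h.le
      have := h1 y hy h (by linarith)
      constructor <;> linarith
    · simpa using he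
    · have := hmono hy hx h.le
      have := h2 y hy h (by linarith)
      constructor <;> linarith
  · intro x hx hax
    refine ⟨δ x, hδ x, fun y hxy hy hyb => ?_⟩
    have := hadd hax hyb (.single (k := k) hxy ⟨hx, hy⟩)
    linarith

theorem IsHKPrimitive.exists_continuousOn_right (hF : IsHKPrimitive g F a b) (hab : a ≤ b)
    {ε : ℝ} (hε : 0 < ε) :
    ∃ H : ℝ → ℝ, ContinuousOn H (Set.Icc a b) ∧ MonotoneOn H (Set.Icc a b) ∧ H b - H a ≤ ε ∧
      ∀ x, a ≤ x → ∃ η > 0, ∀ y, x ≤ y → y < x + η → y ≤ b →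
        g x * (y - x) - (F y - F x) ≤ H y - H x := by
  -- The tags are sorted by the integer part of |g|, and the bounds ε/2/2^n sum to ε.
  choose H hc hm hbd hd using fun n : ℕ =>
    hF.exists_continuousOn_of_bounded (E := {x | ⌊|g x|⌋₊ = n}) (N := n + 1)
      (fun x (hx : _ = n) => hx ▸ (Nat.lt_floor_add_one |g x|).le)
      (show 0 < ε / 2 / 2 ^ n by positivity)
  have hsum := summable_geometric_two' ε
  have hs : ∀ x ∈ Set.Icc a b, Summable fun n => H n x := fun x hx =>
    .of_nonneg_of_le (fun n => (hbd n x hx).1) (fun n => (hbd n x hx).2) hsum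
  have ha : a ∈ Set.Icc a b := ⟨le_rfl, hab⟩
  have hb : b ∈ Set.Icc a b := ⟨hab, le_rfl⟩
  refine ⟨fun x => ∑' n, H n x, ?_, ?_, ?_, ?_⟩
  · refine continuousOn_tsum hc hsum fun n x hx => ?_
    rw [Real.norm_eq_abs, abs_of_nonneg (hbd n x hx).1]
    exact (hbd n x hx).2
  · exact fun x hx y hy hxy => (hs x hx).tsum_le_tsum (fun n => hm n hx hy hxy) (hs y hy)
  · have h1 : ∑' n, H n b ≤ ε := by
      rw [← tsum_geometric_two' ε]
      exact (hs b hb).tsum_le_tsum (fun n => (hbd n b hb).2) hsum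
    have h2 : 0 ≤ ∑' n, H n a := tsum_nonneg fun n => (hbd n a ha).1
    linarith
  · intro x hax
    obtain ⟨η, hη, h⟩ := hd ⌊|g x|⌋₊ x rfl hax
    refine ⟨η, hη, fun y hxy hy hyb => (h y hxy hy hyb).trans ?_⟩
    have hxm : x ∈ Set.Icc a b := ⟨hax, hxy.trans hyb⟩
    have hym : y ∈ Set.Icc a b := ⟨hax.trans hxy, hyb⟩
    rw [← (hs y hym).tsum_sub (hs x hxm)]
    -- Only the layer containing `x` is needed; the increments of the others are nonnegative.
    exact ((hs y hym).sub (hs x hxm)).le_tsum ⌊|g x|⌋₊ fun n _ =>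
      sub_nonneg.2 (hm n hxm hym hxy)

/-- `H₁` handles the right derivates and the reflected `H₂` the left ones. Each is monotone in the
direction that cannot spoil the other side. -/
theorem IsHKPrimitive.exists_isMajor (hF : IsHKPrimitive g F a b) (hab : a ≤ b) {ε : ℝ}
    (hε : 0 < ε) : ∃ U, IsMajor U g a b ∧ U b - U a ≤ F b - F a + ε := by
  obtain ⟨H₁, hc₁, hm₁, hb₁, hd₁⟩ := hF.exists_continuousOn_right hab (half_pos hε)
  obtain ⟨H₂, hc₂, hm₂, hb₂, hd₂⟩ :=
    hF.comp_neg.exists_continuousOn_right (neg_le_neg hab) (half_pos hε)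
  have hmaps : Set.MapsTo (fun x : ℝ => -x) (Set.Icc a b) (Set.Icc (-b) (-a)) := fun x hx =>
    ⟨neg_le_neg hx.2, neg_le_neg hx.1⟩
  refine ⟨fun x => F x + H₁ x - H₂ (-x), isMajor_of_forall_le_sub
    ((hF.continuousOn.add hc₁).sub (hc₂.comp continuousOn_neg hmaps)) ?_ ?_, by linarith⟩
  · intro x hx
    obtain ⟨η, hη, h⟩ := hd₁ x hx.1
    refine ⟨η, hη, fun y hxy hy hyb => ?_⟩
    have := h y hxy hy hyb
    have := hm₂ (hmaps ⟨hx.1.trans hxy, hyb⟩) (hmaps ⟨hx.1, hx.2.le⟩) (neg_le_neg hxy)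
    linarith
  · intro x hx
    obtain ⟨η, hη, h⟩ := hd₂ (-x) (neg_le_neg hx.2)
    refine ⟨η, hη, fun y hyx hy hay => ?_⟩
    have := h (-y) (by linarith) (by linarith) (by linarith)
    simp only [neg_neg] at this
    have := hm₁ ⟨hay, hyx.trans hx.2⟩ ⟨hx.1.le, hx.2⟩ hyx
    linarith

theorem IsHKPrimitive.hasLaplaceIntegral (hF : IsHKPrimitive g F a b) (hab : a ≤ b) :
    HasLaplaceIntegral g a b (F b - F a) := by
  refine hasLaplaceIntegral_of_forall_exists hab (fun ε hε => hF.exists_isMajor hab hε)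
    fun ε hε => ?_
  obtain ⟨U, hU, hle⟩ := hF.neg.exists_isMajor hab hε
  refine ⟨fun x => -U x, isMinor_iff_neg.2 ?_, by linarith⟩
  simpa using hU

theorem HKCauchy.hkInt_self (h : HKCauchy g a b) (hab : a ≤ b) : hkInt g a a = 0 := by
  simpa using h.hkInt_add le_rfl le_rfl hab

theorem HKCauchy.hasLaplaceIntegral (h : HKCauchy g a b) (hab : a ≤ b) :
    HasLaplaceIntegral g a b (hkInt g a b) := by
  simpa [h.hkInt_self hab] using h.isHKPrimitive.hasLaplaceIntegral hab

/-- Fine sums show that the integrals over [u, v] tend to `A` jointly in both ends; fixing one end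
separates this into two limits. -/
theorem HasHKIntegralReal.hasLaplaceIntegralReal {A : ℝ} (h : HasHKIntegralReal g A) :
    HasLaplaceIntegralReal g A := by
  have key : ∀ ε > 0, ∃ r > 0, ∀ u v, u < -r → r < v → |hkInt g u 0 + hkInt g 0 v - A| ≤ ε := by
    intro ε hε
    obtain ⟨δ, r, hδ, hr, h'⟩ := hasHKIntegralReal_iff.1 h (ε / 3) (by linarith)
    refine ⟨r, hr, fun u v hu hv => ?_⟩
    rw [(h.hkCauchy u v).hkInt_add (by linarith) (by linarith) le_rfl]
    have h'' := h' u v hu hv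
    obtain ⟨S, hS⟩ := FineSum.exists_of_pos g hδ (show u ≤ v by linarith)
    have h1 := abs_le.1 <| abs_sub_hkInt_le (ε := 2 * (ε / 3)) hδ (fun S S' hS hS' => by
      have h1 := abs_lt.1 (h'' S hS)
      have h2 := abs_lt.1 (h'' S' hS')
      rw [abs_le]
      constructor <;> linarith) hS
    have h2 := abs_lt.1 (h'' S hS)
    rw [abs_le]
    constructor <;> linarith
  obtain ⟨A₂, hA₂⟩ : ∃ A₂, Tendsto (fun v => hkInt g 0 v) atTop (𝓝 A₂) := by
    refine cauchySeq_tendsto_of_complete (Metric.cauchySeq_iff'.2 fun ε hε => ?_)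
    obtain ⟨r, hr, hk⟩ := key (ε / 3) (by linarith)
    -- With the left end fixed at `-r - 1`, its contribution cancels in the difference.
    refine ⟨r + 1, fun v hv => ?_⟩
    have h1 := abs_le.1 (hk (-r - 1) v (by linarith) (by linarith [hv.le]))
    have h2 := abs_le.1 (hk (-r - 1) (r + 1) (by linarith) (by linarith))
    rw [Real.dist_eq, abs_lt]
    constructor <;> linarith
  have hA₁ : Tendsto (fun u => hkInt g u 0) atBot (𝓝 (A - A₂)) := by
    rw [Metric.tendsto_nhds]
    intro ε hε
    obtain ⟨r, hr, hk⟩ := key (ε / 3) (by linarith)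
    obtain ⟨v, hv, hv'⟩ := ((hA₂.eventually (Metric.ball_mem_nhds A₂ (show 0 < ε / 3 by linarith))).and
      (eventually_gt_atTop r)).exists
    filter_upwards [eventually_lt_atBot (-r)] with u hu
    have h1 := abs_le.1 (hk u v hu hv')
    have h2 := abs_lt.1 hv
    rw [Real.dist_eq, abs_lt]
    constructor <;> linarith
  exact ⟨0, A - A₂, A₂, ⟨_, fun c hc => (h.hkCauchy c 0).hasLaplaceIntegral hc, hA₁⟩,
    ⟨_, fun c hc => (h.hkCauchy 0 c).hasLaplaceIntegral hc, hA₂⟩, by ring⟩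

end

/-! ## A vanishing criterion for the Laplace derivative -/

theorem tendsto_rightQuot_zero {f : ℝ → ℝ} {x δ : ℝ} (hf : Continuous f) (hx : f x = 0)
    (hi : Integrable fun t => f (x + t) / t ^ 2) (hδ : 0 < δ) :
    Tendsto (rightQuot f x δ) atTop (𝓝 0) := by
  have heq : rightQuot f x δ =
      fun s => ∫ t in (0 : ℝ)..δ, s ^ 2 * (Real.exp (-(s * t)) * (f (x + t) - f x)) := by
    ext s
    rw [rightQuot, intervalIntegral.integral_const_mul]
  -- The factor (st)²e^{-st} is at most 2 and tends to 0 as s → ∞ for each t > 0, so 2|f(x+t)/t²|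
  -- dominates.
  have hform : ∀ s t : ℝ, 0 < t → s ^ 2 * (Real.exp (-(s * t)) * (f (x + t) - f x)) =
      (s * t) ^ 2 * Real.exp (-(s * t)) * (f (x + t) / t ^ 2) := by
    intro s t ht
    rw [hx]
    field_simp
    ring
  suffices h : Tendsto (rightQuot f x δ) atTop (𝓝 (∫ _ in (0 : ℝ)..δ, (0 : ℝ))) by simpa using h
  rw [heq]
  refine intervalIntegral.tendsto_integral_filter_of_dominated_convergence
    (fun t => 2 * |f (x + t) / t ^ 2|) ?_ ?_ ((hi.abs.const_mul 2).intervalIntegrable) ?_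
  · exact .of_forall fun s => Continuous.aestronglyMeasurable (by fun_prop)
  · filter_upwards [eventually_ge_atTop 0] with s hs
    refine .of_forall fun t ht => ?_
    rw [Set.uIoc_of_le hδ.le] at ht
    rw [hform s t ht.1, norm_mul, Real.norm_eq_abs, Real.norm_eq_abs]
    refine mul_le_mul_of_nonneg_right ?_ (abs_nonneg _)
    have hst : 0 ≤ s * t := mul_nonneg hs ht.1.le
    rw [abs_of_nonneg (by positivity), Real.exp_neg, ← div_eq_mul_inv,
      div_le_iff₀ (Real.exp_pos _)]
    have := Real.quadratic_le_exp_of_nonneg hst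
    linarith
  · refine .of_forall fun t ht => ?_
    rw [Set.uIoc_of_le hδ.le] at ht
    simp only [hform _ t ht.1]
    have := ((Real.tendsto_pow_mul_exp_neg_atTop_nhds_zero 2).comp
      (tendsto_id.atTop_mul_const ht.1)).mul_const (f (x + t) / t ^ 2)
    simpa using this

theorem hasLaplaceDerivAt_zero {f : ℝ → ℝ} {x : ℝ} (hf : Continuous f) (hx : f x = 0)
    (hi : Integrable fun t => f (x + t) / t ^ 2) : HasLaplaceDerivAt f 0 x := by
  refine ⟨1, one_pos, hf.intervalIntegrable _ _, tendsto_rightQuot_zero hf hx hi one_pos, ?_⟩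
  simp only [funext (leftQuot_eq_rightQuot f x _)]
  refine tendsto_rightQuot_zero (by fun_prop) (by simp [hx]) ?_ one_pos
  have := hi.comp_neg.neg
  refine this.congr (.of_forall fun t => ?_)
  simp only [Pi.neg_apply, neg_add_rev, neg_neg, neg_sq, neg_div]
  rw [add_comm]

/-! ## The tent map of slope three -/

/-- The tent map whose points with bounded orbit form the ternary Cantor set. -/
noncomputable def tent (y : ℝ) : ℝ := 3 / 2 - 3 * |y - 1 / 2|

/-- `y` lies in one of the gaps of the Cantor set removed at stage `n`. -/
def InGap (n : ℕ) (y : ℝ) : Prop := tent^[n] y ∈ Set.Ioo (1 / 3 : ℝ) (2 / 3)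

theorem tent_of_le {y : ℝ} (h : y ≤ 1 / 2) : tent y = 3 * y := by
  rw [tent, abs_of_nonpos (by linarith)]
  ring

theorem tent_of_ge {y : ℝ} (h : 1 / 2 ≤ y) : tent y = 3 - 3 * y := by
  rw [tent, abs_of_nonneg (by linarith)]
  ring

theorem continuous_tent : Continuous tent := by
  unfold tent
  fun_prop

theorem continuous_iterate_tent (n : ℕ) : Continuous tent^[n] := continuous_tent.iterate n

theorem abs_tent_sub_le (x y : ℝ) : |tent x - tent y| ≤ 3 * |x - y| := by
  have := abs_abs_sub_abs_le_abs_sub (y - 1 / 2) (x - 1 / 2)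
  rw [show y - 1 / 2 - (x - 1 / 2) = y - x by ring, abs_sub_comm y x] at this
  unfold tent
  rw [show 3 / 2 - 3 * |x - 1 / 2| - (3 / 2 - 3 * |y - 1 / 2|) =
    3 * (|y - 1 / 2| - |x - 1 / 2|) by ring, abs_mul, abs_of_pos (by norm_num : (0 : ℝ) < 3)]
  linarith

theorem abs_iterate_tent_sub_le (n : ℕ) (x y : ℝ) :
    |tent^[n] x - tent^[n] y| ≤ 3 ^ n * |x - y| := by
  induction n with
  | zero => simp
  | succ n ih =>
    rw [Function.iterate_succ_apply', Function.iterate_succ_apply']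
    refine (abs_tent_sub_le _ _).trans ?_
    rw [pow_succ]
    linarith

theorem tent_neg {z : ℝ} (h : z < 0 ∨ 1 < z) : tent z < 0 := by
  rcases h with h | h
  · rw [tent_of_le (by linarith)]; linarith
  · rw [tent_of_ge (by linarith)]; linarith

theorem iterate_tent_neg {m n : ℕ} {y : ℝ} (hmn : m < n) (h : tent^[m] y < 0 ∨ 1 < tent^[m] y) :
    tent^[n] y < 0 := by
  induction n, hmn using Nat.le_induction with
  | base => rw [Function.iterate_succ_apply']; exact tent_neg h
  | succ n _ ih => rw [Function.iterate_succ_apply']; exact tent_neg (.inl ih)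

theorem InGap.one_lt {n : ℕ} {y : ℝ} (h : InGap n y) : 1 < tent^[n + 1] y := by
  rw [Function.iterate_succ_apply', tent]
  have : |tent^[n] y - 1 / 2| < 1 / 6 := by
    rw [abs_lt]
    constructor <;> linarith [h.1, h.2]
  linarith

theorem InGap.iterate_neg_or {m n : ℕ} {y : ℝ} (h : InGap m y) (hmn : m < n) :
    tent^[n] y < 0 ∨ 1 < tent^[n] y := by
  rcases (Nat.succ_le_of_lt hmn).eq_or_lt with rfl | h1
  · exact .inr h.one_lt
  · exact .inl (iterate_tent_neg h1 (.inr h.one_lt))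

/-- An orbit that visits the middle third leaves [0, 1] at the next step and never returns. -/
theorem InGap.eq {m n : ℕ} {y : ℝ} (hm : InGap m y) (hn : InGap n y) : m = n := by
  by_contra hne
  wlog h : m < n generalizing m n
  · exact this hn hm (Ne.symm hne) (by omega)
  rcases hm.iterate_neg_or h with h1 | h1
  · linarith [hn.1]
  · linarith [hn.2]

theorem not_inGap {y : ℝ} (h : ∀ n, tent^[n] y ∈ Set.Icc (0 : ℝ) 1) (n : ℕ) : ¬ InGap n y :=
  fun hn => absurd (h (n + 1)).2 hn.one_lt.not_ge

theorem iterate_tent_mem_Icc_zero (n : ℕ) : tent^[n] 0 ∈ Set.Icc (0 : ℝ) 1 := by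
  have : tent^[n] 0 = 0 := Function.iterate_fixed (by rw [tent_of_le] <;> norm_num) n
  rw [this]
  exact ⟨le_rfl, zero_le_one⟩

theorem iterate_tent_mem_Icc_one (n : ℕ) : tent^[n] 1 ∈ Set.Icc (0 : ℝ) 1 := by
  cases n with
  | zero => exact ⟨zero_le_one, le_rfl⟩
  | succ n =>
    rw [Function.iterate_succ_apply, show tent 1 = 0 by rw [tent_of_ge] <;> norm_num]
    exact iterate_tent_mem_Icc_zero n

/-- Each of the two branches contracts by 3, so the factor is 2/3; the bound 1 is enough below. -/
theorem volume_preimage_tent_le {s : Set ℝ} (hs : MeasurableSet s) :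
    volume (tent ⁻¹' s) ≤ volume s := by
  have hsub : tent ⁻¹' s ⊆ (3 * ·) ⁻¹' s ∪ (3 * ·) ⁻¹' ((fun z => 3 - z) ⁻¹' s) := by
    intro y hy
    rcases le_total y (1 / 2) with h | h
    · left
      simpa [tent_of_le h] using hy
    · right
      simpa [tent_of_ge h] using hy
  refine (measure_mono hsub).trans ((measure_union_le _ _).trans ?_)
  rw [Real.volume_preimage_mul_left (by norm_num), Real.volume_preimage_mul_left (by norm_num),
    (Measure.measurePreserving_sub_left volume (3 : ℝ)).measure_preimage hs.nullMeasurableSet,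
    ← add_mul, ← ENNReal.ofReal_add (by positivity) (by positivity)]
  refine mul_le_of_le_one_left zero_le ?_
  rw [ENNReal.ofReal_le_one]
  norm_num [abs_of_pos]

theorem volume_preimage_iterate_tent_le (n : ℕ) {s : Set ℝ} (hs : MeasurableSet s) :
    volume (tent^[n] ⁻¹' s) ≤ volume s := by
  induction n with
  | zero => simp
  | succ n ih =>
    rw [Function.iterate_succ, Set.preimage_comp]
    exact (volume_preimage_tent_le ((continuous_iterate_tent n).measurable hs)).trans ih

theorem differentiableAt_iterate_tent {n : ℕ} {y : ℝ} (h : ∀ m < n, tent^[m] y ≠ 1 / 2) :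
    DifferentiableAt ℝ tent^[n] y := by
  induction n with
  | zero => exact differentiableAt_id
  | succ n ih =>
    rw [Function.iterate_succ']
    refine DifferentiableAt.comp y ?_ (ih fun m hm => h m (by omega))
    have h1 : tent^[n] y - 1 / 2 ≠ 0 := sub_ne_zero.2 (h n (by omega))
    unfold tent
    exact (((differentiableAt_id.sub_const _).abs h1).const_mul _).const_sub _

/-! ## Bumps in the gaps of the Cantor set -/

/-- A bump at `1/2` of rapidly decreasing width. -/
noncomputable def gapBump (n : ℕ) : ContDiffBump (1 / 2 : ℝ) where
  rIn := 1 / (24 * 100 ^ n)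
  -- The bump stays at distance at least 1/12 from the complement of (1/3, 2/3), and 100^n outgrows
  -- 9^n (2/3)^n = 6^n in `integrable_cantorBump_div`.
  rOut := 1 / (12 * 100 ^ n)
  rIn_pos := by positivity
  rIn_lt_rOut := by gcongr; norm_num

/-- A continuous function with narrow bumps of height `(2/3)^n` in the gaps of stage `n`. -/
noncomputable def cantorBump (y : ℝ) : ℝ := ∑' n : ℕ, (2 / 3) ^ n * gapBump n (tent^[n] y)

open Classical in
/-- The Laplace derivative of `cantorBump`. -/
noncomputable def cantorBumpDeriv (y : ℝ) : ℝ := if ∃ n, InGap n y then deriv cantorBump y else 0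

theorem continuous_cantorBump : Continuous cantorBump := by
  refine continuous_tsum (u := fun n => (2 / 3 : ℝ) ^ n) (fun n => ?_)
    (summable_geometric_of_lt_one (by norm_num) (by norm_num)) fun n y => ?_
  · exact continuous_const.mul ((gapBump n).continuous.comp (continuous_iterate_tent n))
  · rw [Real.norm_eq_abs, abs_of_nonneg (mul_nonneg (by positivity) (gapBump n).nonneg)]
    exact mul_le_of_le_one_right (by positivity) (gapBump n).le_one

theorem abs_sub_lt_of_gapBump_ne_zero {n : ℕ} {z : ℝ} (h : gapBump n z ≠ 0) :
    |z - 1 / 2| < 1 / (12 * 100 ^ n) := by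
  have : z ∈ Function.support (gapBump n) := h
  rw [(gapBump n).support_eq] at this
  exact this

theorem inGap_of_gapBump_ne_zero {n : ℕ} {y : ℝ} (h : gapBump n (tent^[n] y) ≠ 0) :
    InGap n y := by
  have h1 := abs_sub_lt_of_gapBump_ne_zero h
  have h2 : (1 : ℝ) / (12 * 100 ^ n) ≤ 1 / 12 := by
    have : (1 : ℝ) ≤ 100 ^ n := one_le_pow₀ (by norm_num)
    gcongr
    linarith
  have h3 := abs_lt.1 (h1.trans_le h2)
  constructor <;> linarith

theorem cantorBump_of_inGap {n : ℕ} {y : ℝ} (h : InGap n y) :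
    cantorBump y = (2 / 3) ^ n * gapBump n (tent^[n] y) := by
  refine tsum_eq_single n fun m hm => ?_
  by_contra hne
  exact hm ((inGap_of_gapBump_ne_zero (right_ne_zero_of_mul hne)).eq h)

theorem cantorBump_eq_zero {y : ℝ} (h : ∀ n, ¬ InGap n y) : cantorBump y = 0 := by
  refine (tsum_congr fun n => ?_).trans tsum_zero
  by_contra hne
  exact h n (inGap_of_gapBump_ne_zero (right_ne_zero_of_mul hne))

theorem cantorBumpDeriv_eq_zero {y : ℝ} (h : ∀ n, ¬ InGap n y) : cantorBumpDeriv y = 0 :=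
  if_neg (by simpa using h)

theorem differentiableAt_cantorBump {n : ℕ} {y : ℝ} (h : InGap n y) :
    DifferentiableAt ℝ cantorBump y := by
  have hev : cantorBump =ᶠ[𝓝 y] fun z => (2 / 3) ^ n * gapBump n (tent^[n] z) := by
    filter_upwards [(continuous_iterate_tent n).continuousAt.preimage_mem_nhds
      (isOpen_Ioo.mem_nhds h)] with z hz
    exact cantorBump_of_inGap hz
  refine DifferentiableAt.congr_of_eventuallyEq ?_ hev
  have hd : DifferentiableAt ℝ tent^[n] y := differentiableAt_iterate_tent fun m hm heq => by
    have hm' : InGap m y := by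
      rw [InGap, heq]
      norm_num
    exact hm.ne (hm'.eq h)
  exact DifferentiableAt.const_mul (DifferentiableAt.comp y
    ((gapBump n).contDiff (n := 1)).differentiable_one.differentiableAt hd) _

/-- The `n`-th iterates of `x` and `x + t` differ by at least 1/12 and the iterate is 3^n-Lipschitz,
so |t| ≥ 1/(12 · 3^n). -/
theorem one_le_mul_sq_of_gapBump_ne_zero {n : ℕ} {x t : ℝ} (hx : ¬ InGap n x)
    (ht : gapBump n (tent^[n] (x + t)) ≠ 0) : 1 ≤ 144 * 9 ^ n * t ^ 2 := by
  have h1 := abs_sub_lt_of_gapBump_ne_zero ht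
  have h2 : (1 : ℝ) / (12 * 100 ^ n) ≤ 1 / 12 := by
    have : (1 : ℝ) ≤ 100 ^ n := one_le_pow₀ (by norm_num)
    gcongr
    linarith
  have h3 := abs_lt.1 (h1.trans_le h2)
  have h4 := abs_iterate_tent_sub_le n (x + t) x
  rw [add_sub_cancel_left] at h4
  have h5 : 1 / 12 ≤ |tent^[n] (x + t) - tent^[n] x| := by
    by_contra! hlt
    have h6 := abs_lt.1 hlt
    exact hx ⟨by linarith, by linarith⟩
  have h7 : 1 ≤ 12 * (3 ^ n * |t|) := by linarith
  have h8 : 1 ≤ (12 * (3 ^ n * |t|)) ^ 2 := one_le_pow₀ h7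
  rw [mul_pow, mul_pow, sq_abs, ← pow_mul, mul_comm n, pow_mul] at h8
  norm_num at h8
  linarith

/-- On the bumps of stage `n`, 1/t² is at most 144 · 9^n, the height is at most (2/3)^n, and the
total measure is at most 1/(6 · 100^n). The product is 24 (6/100)^n, which is summable. -/
theorem integrable_cantorBump_div {x : ℝ} (hx : ∀ n, ¬ InGap n x) :
    Integrable fun t => cantorBump (x + t) / t ^ 2 := by
  have hnn : ∀ y, 0 ≤ cantorBump y := fun y =>
    tsum_nonneg fun n => mul_nonneg (by positivity) (gapBump n).nonneg
  set B : ℕ → Set ℝ := fun n => Metric.ball (1 / 2 : ℝ) (1 / (12 * 100 ^ n))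
  set s : ℕ → Set ℝ := fun n => (fun t => x + t) ⁻¹' (tent^[n] ⁻¹' B n) with hs
  have hmeas : ∀ n, MeasurableSet (tent^[n] ⁻¹' B n) := fun n =>
    (continuous_iterate_tent n).measurable measurableSet_ball
  have hsm : ∀ n, MeasurableSet (s n) := fun n => (measurable_const_add x) (hmeas n)
  have hvol : ∀ n, volume (s n) ≤ ENNReal.ofReal (2 * (1 / (12 * 100 ^ n))) := fun n => by
    rw [hs]
    simp only
    rw [measure_preimage_add]
    refine (volume_preimage_iterate_tent_le n measurableSet_ball).trans ?_
    rw [Real.volume_ball]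
  have hle : ∀ t, ENNReal.ofReal (cantorBump (x + t) / t ^ 2) ≤
      ∑' n, ENNReal.ofReal ((2 / 3) ^ n * (144 * 9 ^ n)) * (s n).indicator 1 t := by
    intro t
    by_cases h0 : cantorBump (x + t) = 0
    · simp [h0]
    obtain ⟨n, hn⟩ : ∃ n, InGap n (x + t) := by
      by_contra! hne
      exact h0 (cantorBump_eq_zero hne)
    rw [cantorBump_of_inGap hn] at h0 ⊢
    have hb := right_ne_zero_of_mul h0
    have hts : t ∈ s n := abs_sub_lt_of_gapBump_ne_zero hb
    have hsq := one_le_mul_sq_of_gapBump_ne_zero (hx n) hb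
    refine le_trans ?_ (ENNReal.le_tsum n)
    rw [Set.indicator_of_mem hts, Pi.one_apply, mul_one]
    refine ENNReal.ofReal_le_ofReal ?_
    have ht2 : 0 < t ^ 2 := by
      rcases (sq_nonneg t).eq_or_lt with h | h
      · rw [← h] at hsq
        norm_num at hsq
      · exact h
    rw [div_le_iff₀ ht2, mul_assoc]
    refine mul_le_mul_of_nonneg_left ?_ (by positivity)
    exact (gapBump n).le_one.trans (by linarith)
  refine ⟨(Measurable.aestronglyMeasurable (by
    have := continuous_cantorBump.measurable
    fun_prop)), ?_⟩
  rw [hasFiniteIntegral_iff_ofReal (.of_forall fun t => div_nonneg (hnn _) (sq_nonneg t))]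
  refine (lintegral_mono hle).trans_lt ?_
  rw [lintegral_tsum fun n => ((measurable_one.indicator (hsm n)).const_mul _).aemeasurable]
  have hterm : ∀ n, ∫⁻ t, ENNReal.ofReal ((2 / 3) ^ n * (144 * 9 ^ n)) * (s n).indicator 1 t ≤
      ENNReal.ofReal (24 * (6 / 100) ^ n) := by
    intro n
    rw [lintegral_const_mul _ (measurable_one.indicator (hsm n)), lintegral_indicator_one (hsm n)]
    refine (mul_le_mul_right (hvol n) _).trans ?_
    rw [← ENNReal.ofReal_mul (by positivity)]
    refine ENNReal.ofReal_le_ofReal (le_of_eq ?_)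
    rw [div_pow, div_pow, show (6 : ℝ) = 2 * 9 / 3 by norm_num, div_pow, mul_pow]
    field_simp
    norm_num
  refine (ENNReal.tsum_le_tsum hterm).trans_lt ?_
  rw [← ENNReal.ofReal_tsum_of_nonneg (fun n => by positivity)
    ((summable_geometric_of_lt_one (by norm_num) (by norm_num)).mul_left _)]
  exact ENNReal.ofReal_lt_top

theorem hasLaplaceDerivAt_cantorBump (x : ℝ) :
    HasLaplaceDerivAt cantorBump (cantorBumpDeriv x) x := by
  by_cases h : ∃ n, InGap n x
  · rw [cantorBumpDeriv, if_pos h]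
    obtain ⟨n, hn⟩ := h
    exact hasLaplaceDerivAt_of_hasDerivAt continuous_cantorBump
      (differentiableAt_cantorBump hn).hasDerivAt
  · rw [cantorBumpDeriv, if_neg h]
    push Not at h
    exact hasLaplaceDerivAt_zero continuous_cantorBump (cantorBump_eq_zero h)
      (integrable_cantorBump_div h)

/-! ## The derivative of `cantorBump` is not Henstock–Kurzweil integrable -/

/-- The intervals of length `3⁻ᵐ` of the construction of the Cantor set. -/
inductive CantorInterval : ℕ → ℝ → ℝ → Prop
  | zero : CantorInterval 0 0 1
  | left {m : ℕ} {p q : ℝ} : CantorInterval m p q → CantorInterval (m + 1) p (p + (q - p) / 3)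
  | right {m : ℕ} {p q : ℝ} : CantorInterval m p q → CantorInterval (m + 1) (q - (q - p) / 3) q

namespace CantorInterval

variable {m : ℕ} {p q : ℝ}

theorem length (h : CantorInterval m p q) : q - p = (1 / 3) ^ m := by
  induction h with
  | zero => norm_num
  | left _ ih => rw [pow_succ, ← ih]; ring
  | right _ ih => rw [pow_succ, ← ih]; ring

theorem lt (h : CantorInterval m p q) : p < q := by
  have := h.length
  have : (0 : ℝ) < (1 / 3) ^ m := by positivity
  linarith

theorem subset (h : CantorInterval m p q) : 0 ≤ p ∧ q ≤ 1 := by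
  induction h with
  | zero => norm_num
  | left h ih => constructor <;> linarith [h.lt]
  | right h ih => constructor <;> linarith [h.lt]

/-- The iterate is affine onto [0, 1] on such an interval; the decreasing branch of the tent map
forces both orientations. -/
theorem iterate_tent (h : CantorInterval m p q) :
    (∀ y, p ≤ y → y ≤ q → tent^[m] y = (y - p) * 3 ^ m) ∨
      ∀ y, p ≤ y → y ≤ q → tent^[m] y = (q - y) * 3 ^ m := by
  induction h with
  | zero => left; simp
  | @left m p q h ih =>
    have hl := h.length
    have hl' := h.lt
    have hm : (q - p) * 3 ^ m = 1 := by rw [hl, ← mul_pow]; norm_num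
    have h3 : (0 : ℝ) < 3 ^ m := by positivity
    rcases ih with ih | ih
    · left
      intro y hp hq
      have : (y - p) * 3 ^ m ≤ (q - p) / 3 * 3 ^ m := by gcongr; linarith
      rw [Function.iterate_succ_apply', ih y hp (by linarith), tent_of_le (by linarith), pow_succ]
      ring
    · left
      intro y hp hq
      have : (2 * (q - p) / 3) * 3 ^ m ≤ (q - y) * 3 ^ m := by gcongr; linarith
      rw [Function.iterate_succ_apply', ih y hp (by linarith), tent_of_ge (by linarith), pow_succ]
      linear_combination (-3) * hm
  | @right m p q h ih =>
    have hl := h.length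
    have hl' := h.lt
    have hm : (q - p) * 3 ^ m = 1 := by rw [hl, ← mul_pow]; norm_num
    have h3 : (0 : ℝ) < 3 ^ m := by positivity
    rcases ih with ih | ih
    · right
      intro y hp hq
      have : (2 * (q - p) / 3) * 3 ^ m ≤ (y - p) * 3 ^ m := by gcongr; linarith
      rw [Function.iterate_succ_apply', ih y (by linarith) hq, tent_of_ge (by linarith), pow_succ]
      linear_combination (-3) * hm
    · right
      intro y hp hq
      have : (q - y) * 3 ^ m ≤ (q - p) / 3 * 3 ^ m := by gcongr; linarith
      rw [Function.iterate_succ_apply', ih y (by linarith) hq, tent_of_le (by linarith), pow_succ]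
      ring

theorem iterate_tent_mem (h : CantorInterval m p q) {y : ℝ} (hp : p ≤ y) (hq : y ≤ q) :
    tent^[m] y ∈ Set.Icc (0 : ℝ) 1 := by
  have hm : (q - p) * 3 ^ m = 1 := by rw [h.length, ← mul_pow]; norm_num
  have h3 : (0 : ℝ) < 3 ^ m := by positivity
  rcases h.iterate_tent with h' | h' <;> rw [h' y hp hq]
  · have h1 : (y - p) * 3 ^ m ≤ (q - p) * 3 ^ m := by gcongr
    exact ⟨mul_nonneg (by linarith) h3.le, by linarith⟩
  · have h1 : (q - y) * 3 ^ m ≤ (q - p) * 3 ^ m := by gcongr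
    exact ⟨mul_nonneg (by linarith) h3.le, by linarith⟩

theorem cantorBump_center (h : CantorInterval m p q) : cantorBump ((p + q) / 2) = (2 / 3) ^ m := by
  have hm : (q - p) * 3 ^ m = 1 := by rw [h.length, ← mul_pow]; norm_num
  have hc : tent^[m] ((p + q) / 2) = 1 / 2 := by
    rcases h.iterate_tent with h' | h' <;>
      rw [h' _ (by linarith [h.lt]) (by linarith [h.lt])] <;> linear_combination hm / 2
  have hg : InGap m ((p + q) / 2) := by
    rw [InGap, hc]
    norm_num
  rw [cantorBump_of_inGap hg, hc, (gapBump m).one_of_mem_closedBall, mul_one]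
  exact Metric.mem_closedBall_self (gapBump m).rIn_pos.le

theorem exists_left_descendant (h : CantorInterval m p q) (n : ℕ) :
    ∃ q' ≤ q, CantorInterval (m + n) p q' := by
  induction n with
  | zero => exact ⟨q, le_rfl, h⟩
  | succ n ih =>
    obtain ⟨q', hq', h'⟩ := ih
    exact ⟨_, by linarith [h'.lt], h'.left⟩

/-- A Baire category argument: some positive lower bound for the gauge `δ` holds at a point of the
Cantor set in each sufficiently small Cantor interval within a fixed one. -/
theorem exists_dense_gauge {δ : ℝ → ℝ} (hδ : ∀ t, 0 < δ t) :
    ∃ η > 0, ∃ M P Q, CantorInterval M P Q ∧ ∀ m p q, CantorInterval m p q → M < m → P ≤ p →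
      q ≤ Q → ∃ t, p ≤ t ∧ t ≤ q ∧ (∀ n, tent^[n] t ∈ Set.Icc (0 : ℝ) 1) ∧ η < δ t := by
  by_contra! hcon
  -- If the claim failed, every Cantor interval would contain a deeper one on whose Cantor points δ
  -- ≤ 1/(N+1). Nesting these for all `N` yields a Cantor point with δ ≤ 0.
  have hstep : ∀ (N : ℕ) (v : {v : ℕ × ℝ × ℝ // CantorInterval v.1 v.2.1 v.2.2}),
      ∃ w : {v : ℕ × ℝ × ℝ // CantorInterval v.1 v.2.1 v.2.2}, v.1.1 < w.1.1 ∧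
        v.1.2.1 ≤ w.1.2.1 ∧ w.1.2.2 ≤ v.1.2.2 ∧ ∀ t, w.1.2.1 ≤ t → t ≤ w.1.2.2 →
          (∀ n, tent^[n] t ∈ Set.Icc (0 : ℝ) 1) → δ t ≤ 1 / ((N : ℝ) + 1) := by
    rintro N ⟨⟨M, P, Q⟩, h⟩
    obtain ⟨m, p, q, h1, h2, h3, h4, h5⟩ := hcon (1 / ((N : ℝ) + 1)) (by positivity) M P Q h
    exact ⟨⟨⟨m, p, q⟩, h1⟩, h2, h3, h4, h5⟩
  choose next hlev hp hq hδ' using hstep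
  set v : ℕ → {v : ℕ × ℝ × ℝ // CantorInterval v.1 v.2.1 v.2.2} :=
    fun n => n.rec ⟨(0, 0, 1), zero⟩ next
  have hv : ∀ n, v (n + 1) = next n (v n) := fun n => rfl
  have hle : ∀ n, n ≤ (v n).1.1 := by
    intro n
    induction n with
    | zero => exact Nat.zero_le _
    | succ n ih => exact ih.trans_lt (hlev n (v n))
  have hmem := Monotone.ciSup_mem_iInter_Icc_of_antitone (f := fun n => (v n).1.2.1)
    (g := fun n => (v n).1.2.2) (monotone_nat_of_le_succ fun n => hp n (v n))
    (antitone_nat_of_succ_le fun n => hq n (v n)) (fun n => (v n).2.lt.le)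
  set t := ⨆ n, (v n).1.2.1
  rw [Set.mem_iInter] at hmem
  -- An orbit outside [0, 1] at time `n` is negative at all later times, but `t` lies in a Cantor
  -- interval of level greater than `n`.
  have ht : ∀ n, tent^[n] t ∈ Set.Icc (0 : ℝ) 1 := by
    intro n
    by_contra hne
    have h1 : tent^[n] t < 0 ∨ 1 < tent^[n] t := by
      rw [Set.mem_Icc, not_and_or, not_le, not_le] at hne
      exact hne
    have h2 := iterate_tent_neg (hle (n + 1)) h1
    have h3 := (v (n + 1)).2.iterate_tent_mem (hmem (n + 1)).1 (hmem (n + 1)).2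
    exact h2.not_ge h3.1
  obtain ⟨N, hN⟩ := exists_nat_one_div_lt (hδ t)
  exact hN.not_ge (hδ' N (v N) t (hmem (N + 1)).1 (hmem (N + 1)).2 ht)

end CantorInterval

theorem not_isHKPrimitive_cantorBump : ¬ IsHKPrimitive cantorBumpDeriv cantorBump 0 1 := by
  intro hF
  obtain ⟨δ, hδ, hS⟩ := hF 1 one_pos
  obtain ⟨η, hη, M, P, Q, hC, hd⟩ := CantorInterval.exists_dense_gauge hδ
  set D : ℝ → ℝ → Prop := fun u v => v < u + δ u with hD
  set k : ℝ → ℝ → ℝ := fun u v =>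
    cantorBumpDeriv u * (v - u) - (cantorBump v - cantorBump u) with hk
  -- Each of the 2^n descendants of level `m + n` contributes -(2/3)^(m+n).
  have key : ∀ n m p q, CantorInterval m p q → M ≤ m → P ≤ p → q ≤ Q → (1 / 3) ^ m < η →
      PartialSum D k p q (-(2 ^ n * (2 / 3) ^ (m + n))) := by
    intro n
    induction n with
    | zero =>
      intro m p q h hm hp hq hlt
      have hpq := h.lt
      -- The tag is a Cantor point in the left third, where function and derivative both vanish, and
      -- the interval runs to the bump's peak at the midpoint. Passing to the left third also
      -- supplies the strict inequality M < m + 1.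
      obtain ⟨t, h1, h2, h3, h4⟩ := hd _ _ _ h.left (by omega) hp (by linarith)
      have hng := not_inGap h3
      have hval : k t ((p + q) / 2) = -(2 / 3) ^ m := by
        simp only [hk]
        rw [cantorBumpDeriv_eq_zero hng, cantorBump_eq_zero hng, h.cantorBump_center]
        ring
      have hDt : D t ((p + q) / 2) := by
        have := h.length
        simp only [hD]
        linarith
      have := PartialSum.skip (k := k) h1 (.cons (by linarith) hDt
        (.zero (show (p + q) / 2 ≤ q by linarith)))
      rw [hval] at this
      simpa using this
    | succ n ih =>
      intro m p q h hm hp hq hlt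
      have hpq := h.lt
      have hlt' : (1 / 3 : ℝ) ^ (m + 1) < η :=
        (pow_le_pow_of_le_one (by norm_num) (by norm_num) (Nat.le_succ m)).trans_lt hlt
      have h1 := ih _ _ _ h.left (by omega) hp (by linarith) hlt'
      have h2 := ih _ _ _ h.right (by omega) (by linarith) hq hlt'
      have h3 := h1.append (.skip (by linarith) h2)
      convert h3 using 1
      rw [show m + 1 + n = m + (n + 1) by ring]
      ring
  -- Descending `n₀` levels makes the interval shorter than η; `n` is then taken so large that
  -- (2/3)^(M+n₀) (4/3)^n exceeds the bound 1.
  obtain ⟨n₀, hn₀⟩ := exists_pow_lt_of_lt_one hη (show (1 / 3 : ℝ) < 1 by norm_num)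
  obtain ⟨Q', hQ', hC'⟩ := hC.exists_left_descendant n₀
  obtain ⟨n, hn⟩ := pow_unbounded_of_one_lt ((3 / 2 : ℝ) ^ (M + n₀))
    (show (1 : ℝ) < 4 / 3 by norm_num)
  have hsum := key n _ _ _ hC' (by omega) le_rfl hQ'
    ((pow_le_pow_of_le_one (by norm_num) (by norm_num) (Nat.le_add_left _ _)).trans_lt hn₀)
  have hle := hsum.abs_le_of_fineSum hδ hF hS (fun _ _ h => h) (fun _ _ => rfl) hC'.subset.1
    hC'.subset.2
  rw [abs_neg, abs_of_nonneg (by positivity), pow_add, mul_left_comm, ← mul_pow,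
    show (2 * (2 / 3) : ℝ) = 4 / 3 by norm_num] at hle
  have h1 : (2 / 3 : ℝ) ^ (M + n₀) * (3 / 2) ^ (M + n₀) = 1 := by
    rw [← mul_pow]
    norm_num
  have h2 : (2 / 3 : ℝ) ^ (M + n₀) * (3 / 2) ^ (M + n₀) < (2 / 3) ^ (M + n₀) * (4 / 3) ^ n := by
    gcongr
  linarith

theorem HasLaplaceIntegral.unique {g : ℝ → ℝ} {a b A B : ℝ} (hA : HasLaplaceIntegral g a b A)
    (hB : HasLaplaceIntegral g a b B) : A = B := hA.1.unique hB.1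

theorem isUnitExample_cantorBump : IsUnitExample cantorBump cantorBumpDeriv := by
  have hc := continuous_cantorBump
  have h0 := not_inGap iterate_tent_mem_Icc_zero
  have h1 := not_inGap iterate_tent_mem_Icc_one
  refine ⟨hc.continuousOn, ⟨fun x hx => ?_, fun x hx => ?_⟩, cantorBump_eq_zero h0,
    cantorBump_eq_zero h1, cantorBumpDeriv_eq_zero h0, cantorBumpDeriv_eq_zero h1, ?_, ?_⟩
  · exact ⟨1 - x, sub_pos.2 hx.2, by linarith, hc.intervalIntegrable _ _,
      ((hasLaplaceDerivAt_cantorBump x).tendsto hc (sub_pos.2 hx.2)).1⟩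
  · exact ⟨x, hx.1, by linarith, hc.intervalIntegrable _ _,
      ((hasLaplaceDerivAt_cantorBump x).tendsto hc hx.1).2⟩
  · exact ⟨_, hasLaplaceIntegral_of_hasLaplaceDerivAt zero_le_one hc hasLaplaceDerivAt_cantorBump⟩
  · rintro ⟨A, hA⟩
    have hF := hA.hkCauchy.isHKPrimitive
    -- Both increments are the Laplace integral over [0, x], so a Henstock–Kurzweil primitive would
    -- differ from `cantorBump` by a constant.
    have heq : ∀ x, 0 ≤ x → x ≤ 1 → hkInt cantorBumpDeriv 0 x - hkInt cantorBumpDeriv 0 0 =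
        cantorBump x - cantorBump 0 := fun x hx hx' =>
      ((hF.mono le_rfl hx').hasLaplaceIntegral hx).unique
        (hasLaplaceIntegral_of_hasLaplaceDerivAt hx hc hasLaplaceDerivAt_cantorBump)
    refine not_isHKPrimitive_cantorBump fun ε hε => ?_
    obtain ⟨δ, hδ, h⟩ := hF ε hε
    refine ⟨δ, hδ, fun c d S hc hd hS => ?_⟩
    convert h c d S hc hd hS using 2
    have h2 := heq c hc (hS.le.trans hd)
    have h3 := heq d (hc.trans hS.le) hd
    linarith

/-! ## Extension by zero -/

section

variable {f φ : ℝ → ℝ}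

theorem extendZero_of_mem {x : ℝ} (hx : x ∈ Set.Icc (0 : ℝ) 1) : extendZero f x = f x :=
  Set.indicator_of_mem hx f

theorem extendZero_of_le_zero (h0 : f 0 = 0) {x : ℝ} (hx : x ≤ 0) : extendZero f x = 0 := by
  rcases hx.eq_or_lt with rfl | h
  · rw [extendZero_of_mem (by simp), h0]
  · exact Set.indicator_of_notMem (fun h' => h.not_ge h'.1) f

theorem extendZero_of_one_le (h1 : f 1 = 0) {x : ℝ} (hx : 1 ≤ x) : extendZero f x = 0 := by
  rcases hx.eq_or_lt with rfl | h
  · rw [extendZero_of_mem (by simp), h1]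
  · exact Set.indicator_of_notMem (fun h' => h.not_ge h'.2) f

theorem continuous_extendZero (hf : ContinuousOn f (Set.Icc 0 1)) (h0 : f 0 = 0) (h1 : f 1 = 0) :
    Continuous (extendZero f) := by
  have heq : extendZero f = fun x => f (Set.projIcc (0 : ℝ) 1 zero_le_one x) := by
    ext x
    rcases le_total x 0 with h | h
    · rw [extendZero_of_le_zero h0 h, Set.projIcc_of_le_left _ h, h0]
    rcases le_total 1 x with h' | h'
    · rw [extendZero_of_one_le h1 h', Set.projIcc_of_right_le _ h', h1]
    · rw [extendZero_of_mem ⟨h, h'⟩, Set.projIcc_of_mem _ ⟨h, h'⟩]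
  rw [heq]
  exact (continuousOn_iff_continuous_domRestrict.1 hf).comp continuous_projIcc

theorem rightQuot_congr {g h : ℝ → ℝ} {x δ : ℝ} (hδ : 0 ≤ δ)
    (heq : ∀ t, 0 ≤ t → t ≤ δ → g (x + t) = h (x + t)) : rightQuot g x δ = rightQuot h x δ := by
  ext s
  unfold rightQuot
  congr 1
  refine intervalIntegral.integral_congr fun t ht => ?_
  rw [Set.uIcc_of_le hδ] at ht
  have h0 := heq 0 le_rfl hδ
  rw [add_zero] at h0
  simp only [heq t ht.1 ht.2, h0]

theorem leftQuot_congr {g h : ℝ → ℝ} {x δ : ℝ} (hδ : 0 ≤ δ)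
    (heq : ∀ t, 0 ≤ t → t ≤ δ → g (x - t) = h (x - t)) : leftQuot g x δ = leftQuot h x δ := by
  ext s
  unfold leftQuot
  congr 1
  refine intervalIntegral.integral_congr fun t ht => ?_
  rw [Set.uIcc_of_le hδ] at ht
  have h0 := heq 0 le_rfl hδ
  rw [sub_zero] at h0
  simp only [heq t ht.1 ht.2, h0]

theorem rightQuot_zero_fun (x δ : ℝ) : rightQuot (fun _ => 0) x δ = fun _ => 0 := by
  ext s
  simp [rightQuot]

theorem leftQuot_zero_fun (x δ : ℝ) : leftQuot (fun _ => 0) x δ = fun _ => 0 := by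
  ext s
  simp [leftQuot]

theorem IsUnitExample.continuous_extendZero (h : IsUnitExample f φ) : Continuous (extendZero f) :=
  LaplaceInt.continuous_extendZero h.cont h.f_zero h.f_one

theorem IsUnitExample.hasLaplaceDerivAt_extendZero (h : IsUnitExample f φ) (x : ℝ) :
    HasLaplaceDerivAt (extendZero f) (extendZero φ x) x := by
  have hr : ∃ δ > 0, Tendsto (rightQuot (extendZero f) x δ) atTop (𝓝 (extendZero φ x)) := by
    rcases lt_or_ge x 0 with hx | hx
    · refine ⟨-x, by linarith, ?_⟩
      rw [extendZero_of_le_zero h.phi_zero hx.le, rightQuot_congr (h := fun _ => 0) (by linarith)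
        fun t _ ht => extendZero_of_le_zero h.f_zero (by linarith), rightQuot_zero_fun]
      exact tendsto_const_nhds
    rcases lt_or_ge x 1 with hx' | hx'
    · obtain ⟨δ, h0, h1, -, h2⟩ := h.deriv.1 x ⟨hx, hx'⟩
      refine ⟨δ, h0, ?_⟩
      rwa [extendZero_of_mem ⟨hx, hx'.le⟩, rightQuot_congr (h := f) h0.le
        fun t ht ht' => extendZero_of_mem ⟨by linarith, by linarith⟩]
    · refine ⟨1, one_pos, ?_⟩
      rw [extendZero_of_one_le h.phi_one hx', rightQuot_congr (h := fun _ => 0) zero_le_one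
        fun t ht _ => extendZero_of_one_le h.f_one (by linarith), rightQuot_zero_fun]
      exact tendsto_const_nhds
  have hl : ∃ δ > 0, Tendsto (leftQuot (extendZero f) x δ) atTop (𝓝 (extendZero φ x)) := by
    rcases lt_or_ge 1 x with hx | hx
    · refine ⟨x - 1, by linarith, ?_⟩
      rw [extendZero_of_one_le h.phi_one hx.le, leftQuot_congr (h := fun _ => 0) (by linarith)
        fun t _ ht => extendZero_of_one_le h.f_one (by linarith), leftQuot_zero_fun]
      exact tendsto_const_nhds
    rcases lt_or_ge 0 x with hx' | hx'
    · obtain ⟨δ, h0, h1, -, h2⟩ := h.deriv.2 x ⟨hx', hx⟩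
      refine ⟨δ, h0, ?_⟩
      rwa [extendZero_of_mem ⟨hx'.le, hx⟩, leftQuot_congr (h := f) h0.le
        fun t ht ht' => extendZero_of_mem ⟨by linarith, by linarith⟩]
    · refine ⟨1, one_pos, ?_⟩
      rw [extendZero_of_le_zero h.phi_zero hx', leftQuot_congr (h := fun _ => 0) zero_le_one
        fun t ht _ => extendZero_of_le_zero h.f_zero (by linarith), leftQuot_zero_fun]
      exact tendsto_const_nhds
  obtain ⟨δ₁, h₁, hr⟩ := hr
  obtain ⟨δ₂, h₂, hl⟩ := hl
  exact hasLaplaceDerivAt_of_tendsto h.continuous_extendZero h₁ h₂ hr hl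

theorem IsUnitExample.extendZero_mem_LPReal (h : IsUnitExample f φ) : extendZero φ ∈ LPReal := by
  have hz : ∀ c, c ≤ 0 → extendZero f c = 0 := fun c => extendZero_of_le_zero h.f_zero
  have ho : ∀ c, 1 ≤ c → extendZero f c = 0 := fun c => extendZero_of_one_le h.f_one
  refine ⟨0, 0, 0, 0, ⟨_, fun c hc => hasLaplaceIntegral_of_hasLaplaceDerivAt hc
    h.continuous_extendZero h.hasLaplaceDerivAt_extendZero, ?_⟩,
    ⟨_, fun c hc => hasLaplaceIntegral_of_hasLaplaceDerivAt hc
    h.continuous_extendZero h.hasLaplaceDerivAt_extendZero, ?_⟩, by norm_num⟩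
  · refine tendsto_const_nhds.congr' ?_
    filter_upwards [eventually_le_atBot 0] with c hc
    rw [hz c hc, hz 0 le_rfl, sub_zero]
  · refine tendsto_const_nhds.congr' ?_
    filter_upwards [eventually_ge_atTop 1] with c hc
    rw [ho c hc, hz 0 le_rfl, sub_zero]

theorem hasHKIntegral_of_extendZero {A : ℝ} (h0 : φ 0 = 0) (h1 : φ 1 = 0)
    (h : HasHKIntegralReal (extendZero φ) A) : HasHKIntegral φ 0 1 A := by
  rw [hasHKIntegral_iff]
  intro ε hε
  obtain ⟨δ, r, hδ, hr, h⟩ := hasHKIntegralReal_iff.1 h ε hε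
  refine ⟨δ, hδ, fun S hS => ?_⟩
  -- The sums outside (0, 1) vanish even when tagged at 0 or 1, because φ is zero there.
  obtain ⟨T, hT⟩ := FineSum.exists_of_pos (extendZero φ) hδ (show -r - 1 ≤ 0 by linarith)
  obtain ⟨T', hT'⟩ := FineSum.exists_of_pos (extendZero φ) hδ (show 1 ≤ r + 1 by linarith)
  have hS' : FineSum (extendZero φ) δ 0 1 S :=
    hS.congr fun x hx hx' => (extendZero_of_mem ⟨hx, hx'⟩).symm
  have := h (-r - 1) (r + 1) (by linarith) (by linarith) _ (hT.append (hS'.append hT'))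
  rwa [hT.eq_zero fun x _ hx => extendZero_of_le_zero h0 hx,
    hT'.eq_zero fun x hx _ => extendZero_of_one_le h1 hx, zero_add, add_zero] at this

theorem IsUnitExample.extendZero_mem_diff (h : IsUnitExample f φ) :
    extendZero φ ∈ LPReal \ HKReal :=
  ⟨h.extendZero_mem_LPReal, fun ⟨A, hA⟩ =>
    h.not_mem_HK ⟨A, hasHKIntegral_of_extendZero h.phi_zero h.phi_one hA⟩⟩

end

end LaplaceInt

open LaplaceInt in
theorem mainTheorem9 :
    (∃ f φ : ℝ → ℝ, IsUnitExample f φ) ∧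
    (∀ f φ : ℝ → ℝ, IsUnitExample f φ →
      Continuous (extendZero f) ∧
      (∀ x : ℝ, HasLaplaceDerivAt (extendZero f) (extendZero φ x) x) ∧
      extendZero φ ∈ LPReal \ HKReal) ∧
    (LPReal \ HKReal).Nonempty ∧
    (∀ (g : ℝ → ℝ) (A : ℝ), HasHKIntegralReal g A → HasLaplaceIntegralReal g A) ∧
    HKReal ⊂ LPReal := by
  have hne := isUnitExample_cantorBump.extendZero_mem_diff
  exact ⟨⟨_, _, isUnitExample_cantorBump⟩,
    fun f φ h => ⟨h.continuous_extendZero, h.hasLaplaceDerivAt_extendZero, h.extendZero_mem_diff⟩,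
    ⟨_, hne⟩, fun g A h => h.hasLaplaceIntegralReal,
    fun g ⟨A, hA⟩ => ⟨A, hA.hasLaplaceIntegralReal⟩, fun hsub => hne.2 (hsub hne.1)⟩
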